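/- Let $\mathscr V$ be a braided monoidal category with braiding $c_{X,Y}\colon X\otimes Y\to Y\otimes X$ and unit $I$ (associativity and unit constraints are suppressed). Let $A=(A,\mu_A,\eta_A)$ be a commutative monoid in $\mathscr V$ (that is, $\mu_A\circ c_{A,A}=\mu_A$) and $B=(B,\mu_B,\eta_B,\delta_B,\varepsilon_B)$ a bimonoid in $\mathscr V$. Tensor products of monoids are monoids via the braiding, and for morphisms $u\colon X\to M$, $v\colon Y\to M$ into a monoid $M$ put $u\bullet v=\mu_M\circ(u\otimes v)\colon X\otimes Y\to M$. Write $\mu_A^{(3)}\colon A\otimes A\otimes A\to A$ for the ternary multiplication. A *twisted coaction* of $B$ on $A$ consists of a monoid morphism $\gamma\colon A\to A\otimes B$ and a morphism $\tau\colon I\to A\otimes B\otimes B$ with - $(1_A\otimes\varepsilon_B)\circ\gamma=1_A$; - $\tau\bullet((\gamma\otimes 1_B)\circ\gamma)=((1_A\otimes\delta_B)\circ\gamma)\bullet\tau$; - $((1_A\otimes\delta_B\otimes 1_B)\circ\tau)\bullet(\tau\otimes\eta_B)=((1_{A\otimes B}\otimes\delta_B)\circ\tau)\bullet((\gamma\otimes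 1_{B\otimes B})\circ\tau)$; - $(1_{A\otimes B}\otimes\varepsilon_B)\circ\tau=\eta_A\otimes\eta_B=(1_A\otimes\varepsilon_B\otimes 1_B)\circ\tau$. Put $\zeta=(\eta_A\otimes 1_B)\bullet\gamma\colon B\otimes A\to A\otimes B$, $\delta=(\eta_A\otimes\delta_B)\bullet\tau\colon B\to A\otimes B\otimes B$ and $\varepsilon=\eta_A\circ\varepsilon_B\colon B\to A$. The twisted coaction is *monoidal* when it is equipped with a morphism $\mathfrak d\colon B\to A\otimes B\otimes B$ satisfying 1. $(\mu_A^{(3)}\otimes 1_{B\otimes B})(1_{A\otimes A}\otimes c_{B,A}\otimes 1_B)(1_A\otimes\zeta\otimes\zeta)(1_{A\otimes B}\otimes c_{A,B}^{-1}\otimes 1_A)(\mathfrak d\otimes 1_{A\otimes A})=(\mu_A\otimes 1_{B\otimes B})(1_A\otimes\mathfrak d)\,\zeta\,(1_B\otimes\mu_A)$; 2. $(\mu_A\otimes 1_{B\otimes B\otimes B})(1_A\otimes\mathfrak d\otimes 1_B)\,\mathfrak d=(\mu_A\otimes 1_{B\otimes B\otimes B})(1_A\otimes c_{B,A}\otimes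 1_{B\otimes B})(1_{A\otimes B}\otimes\mathfrak d)\,\mathfrak d$; 3. $(1_{A\otimes B}\otimes\varepsilon_B)\,\mathfrak d=\eta_A\otimes 1_B=(1_A\otimes\varepsilon_B\otimes 1_B)\,\mathfrak d$; 4. $(\mu_A^{(3)}\otimes 1_{B^{\otimes 4}})(1_{A\otimes A}\otimes c_{B\otimes B,A}\otimes 1_{B\otimes B})(1_A\otimes\delta\otimes\delta)\,\mathfrak d=(1_{A\otimes B}\otimes c_{B,B}^{-1}\otimes 1_B)(\mu_A^{(3)}\otimes 1_{B^{\otimes 4}})(1_{A\otimes A}\otimes\mathfrak d\otimes 1_{B\otimes B})(1_A\otimes\zeta\otimes 1_{B\otimes B})(1_{A\otimes B}\otimes\mathfrak d)\,\delta$. Let $T=A\otimes-$. Since $A$ is commutative, $T$ is a monoidal monad with $\phi_{X,X'}=(\mu_A\otimes 1_{X\otimes X'})(1_A\otimes c_{X,A}\otimes 1_{X'})\colon TX\otimes TX'\to T(X\otimes X')$ and $\phi_0=\eta_A\otimes 1_I$, so that its Kleisli category $\mathscr V_T$ is monoidal. A *mixed opwreath* around $T$ is an endofunctor $G$ with natural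 transformations $\zeta\colon GT\Rightarrow TG$, $\delta\colon G\Rightarrow TGG$, $\varepsilon\colon G\Rightarrow T$ forming a comonad on $(\mathscr V,T)$ in the Kleisli completion of the 2-category of categories; equivalently, $\zeta$ lifts $G$ to an endofunctor $\bar G$ of $\mathscr V_T$, on which $\delta$ and $\varepsilon$ form the structure of a comonad. It is *opmonoidal* when the comonad $\bar G$ is equipped with opmonoidal structure, i.e. $\bar G$ is an opmonoidal functor and its comultiplication and counit are opmonoidal natural transformations. Its mixed Kleisli category $\mathrm{mkl}(G,\zeta,T)$ is the Kleisli category of the comonad $\bar G$; it has the objects of $\mathscr V$, and its morphisms from $X$ to $Y$ are the morphisms $GX\to TY$ of $\mathscr V$. **Proposition.** For every monoidal twisted coaction $(\gamma,\tau,\mathfrak d)$ of $B$ on the commutative monoid $A$, the endofunctor $G=B\otimes-$ with the transformations induced by $\zeta,\delta,\varepsilon$ is a mixed opwreath around $T=A\otimes-$, and it is opmonoidal when equipped with the morphisms $$\psi_{X,X'}=(1_A\otimes 1_B\otimes c_{X,B}^{-1}\otimes 1_{X'})\circ(\mathfrak d\otimes 1_X\otimes 1_{X'})\colon G(X\otimes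 X')\to T(GX\otimes GX').$$ Consequently $\mathrm{mkl}(G,\zeta,T)$ is a monoidal category: the tensor product of objects and the unit are those of $\mathscr V$, the tensor product of $f\colon GX\to TY$ and $f'\colon GX'\to TY'$ is $$G(X\otimes X')\xrightarrow{\psi_{X,X'}}T(GX\otimes GX')\xrightarrow{T(f\otimes f')}T(TY\otimes TY')\xrightarrow{T\phi_{Y,Y'}}TT(Y\otimes Y')\xrightarrow{\mu}T(Y\otimes Y'),$$ and the associativity and unit constraints are the images of those of $\mathscr V$. -/

import Mathlib

open CategoryTheory MonoidalCategory

namespace MixedWreath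

universe v u

noncomputable section

/-! ### Monoidal monads and their Kleisli categories -/

section Monads

variable {C : Type u} [Category.{v} C] [MonoidalCategory C]

/-- A monoidal monad: the underlying functor is (lax) monoidal, and the unit and the
multiplication are monoidal natural transformations. -/
class MonoidalMonad (T : CategoryTheory.Monad C) extends T.toFunctor.LaxMonoidal where
  isMonoidal_η : NatTrans.IsMonoidal T.η
  isMonoidal_μ : NatTrans.IsMonoidal T.μ

variable (T : CategoryTheory.Monad C) [MonoidalMonad T]

/-- The tensor constraint `T X ⊗ T Y ⟶ T (X ⊗ Y)` of a monoidal monad. -/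
abbrev MonoidalMonad.φ (X Y : C) : T.obj X ⊗ T.obj Y ⟶ T.obj (X ⊗ Y) :=
  Functor.LaxMonoidal.μ T.toFunctor X Y

/-- The data of the tensor product on the Kleisli category of a monoidal monad: on objects it is
that of `C`, on morphisms it sends `f : X ⟶ T Y` and `f' : X' ⟶ T Y'` to
`X ⊗ X' ⟶ T Y ⊗ T Y' ⟶ T (Y ⊗ Y')`, and the constraints come from `C` along `C ⥤ Kleisli T`. -/
instance kleisliMonoidalStruct : MonoidalCategoryStruct (Kleisli T) where
  tensorObj X Y := .mk T (X.of ⊗ Y.of)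
  tensorUnit := .mk T (𝟙_ C)
  tensorHom {_ Y _ Y'} f g := .mk ((f.of ⊗ₘ g.of) ≫ MonoidalMonad.φ T Y.of Y'.of)
  whiskerLeft X _ Y' g := .mk ((T.η.app X.of ⊗ₘ g.of) ≫ MonoidalMonad.φ T X.of Y'.of)
  whiskerRight {_ Y} f X' := .mk ((f.of ⊗ₘ T.η.app X'.of) ≫ MonoidalMonad.φ T Y.of X'.of)
  associator X Y Z := (Kleisli.Adjunction.toKleisli T).mapIso (α_ X.of Y.of Z.of)
  leftUnitor X := (Kleisli.Adjunction.toKleisli T).mapIso (λ_ X.of)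
  rightUnitor X := (Kleisli.Adjunction.toKleisli T).mapIso (ρ_ X.of)

lemma MonoidalMonad.η_φ (X Y : C) :
    (T.η.app X ⊗ₘ T.η.app Y) ≫ MonoidalMonad.φ T X Y = T.η.app (X ⊗ Y) := by
  have := (MonoidalMonad.isMonoidal_η (T := T)).tensor X Y
  simpa using this.symm

lemma MonoidalMonad.μ_φ (X Y : C) :
    (T.μ.app X ⊗ₘ T.μ.app Y) ≫ MonoidalMonad.φ T X Y =
      MonoidalMonad.φ T (T.obj X) (T.obj Y) ≫ T.map (MonoidalMonad.φ T X Y) ≫ T.μ.app (X ⊗ Y) := by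
  have := (MonoidalMonad.isMonoidal_μ (T := T)).tensor X Y
  simpa using this.symm

lemma MonoidalMonad.ε_eq : Functor.LaxMonoidal.ε T.toFunctor = T.η.app (𝟙_ C) := by
  have := (MonoidalMonad.isMonoidal_η (T := T)).unit
  simpa using this.symm

instance kleisliMonoidal : MonoidalCategory (Kleisli T) := by
  have hK : ∀ {X : C} {Y Z : C} (g : X ⟶ T.obj Y) (f : Y ⟶ Z),
      g ≫ T.map (f ≫ T.η.app Z) ≫ T.μ.app Z = g ≫ T.map f := by
    intro X Y Z g f
    simp
  have hK' : ∀ {X Y Z : C} (f : X ⟶ Y) (g : Y ⟶ T.obj Z),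
      (f ≫ T.η.app Y) ≫ T.map g ≫ T.μ.app Z = f ≫ g := by
    intro X Y Z f g
    have h : g ≫ T.η.app (T.obj Z) = T.η.app Y ≫ T.map g := T.η.naturality g
    rw [Category.assoc, ← reassoc_of% h, T.left_unit]
    exact congrArg _ (Category.comp_id g)
  have hKt : ∀ {X Y X' Y' : C} (f : X ⟶ Y) (f' : X' ⟶ Y'),
      (Kleisli.Adjunction.toKleisli T).map f ⊗ₘ (Kleisli.Adjunction.toKleisli T).map f' =
        (Kleisli.Adjunction.toKleisli T).map (f ⊗ₘ f') := by
    intro X Y X' Y' f f'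
    apply Kleisli.hom_ext
    change ((f ≫ T.η.app Y) ⊗ₘ (f' ≫ T.η.app Y')) ≫ MonoidalMonad.φ T Y Y' = (f ⊗ₘ f') ≫ T.η.app _
    rw [← MonoidalMonad.η_φ]
    simp
  have hKid : ∀ (X : Kleisli T), 𝟙 X = (Kleisli.Adjunction.toKleisli T).map (𝟙 X.of) :=
    fun X => ((Kleisli.Adjunction.toKleisli T).map_id X.of).symm
  refine MonoidalCategory.ofTensorHom ?_ ?_ ?_ ?_ ?_ ?_ ?_ ?_ ?_
  · intro X Y
    exact Kleisli.hom_ext (MonoidalMonad.η_φ T _ _)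
  · intros; rfl
  · intros; rfl
  · intro X₁ Y₁ Z₁ X₂ Y₂ Z₂ f₁ f₂ g₁ g₂
    apply Kleisli.hom_ext
    change ((f₁.of ⊗ₘ f₂.of) ≫ MonoidalMonad.φ T _ _) ≫
      T.map ((g₁.of ⊗ₘ g₂.of) ≫ MonoidalMonad.φ T _ _) ≫ T.μ.app _ =
      ((f₁.of ≫ T.map g₁.of ≫ T.μ.app _) ⊗ₘ (f₂.of ≫ T.map g₂.of ≫ T.μ.app _)) ≫
        MonoidalMonad.φ T _ _
    simp only [← tensorHom_comp_tensorHom, Category.assoc, MonoidalMonad.μ_φ, Functor.map_comp]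
    rw [Functor.LaxMonoidal.μ_natural_assoc]
  · intro X₁ X₂ X₃ Y₁ Y₂ Y₃ f₁ f₂ f₃
    apply Kleisli.hom_ext
    refine (hK _ _).trans (Eq.trans ?_ (hK' _ _).symm)
    change ((((f₁.of ⊗ₘ f₂.of) ≫ MonoidalMonad.φ T _ _) ⊗ₘ f₃.of) ≫ MonoidalMonad.φ T _ _) ≫
      T.map (α_ _ _ _).hom =
      (α_ _ _ _).hom ≫ (f₁.of ⊗ₘ ((f₂.of ⊗ₘ f₃.of) ≫ MonoidalMonad.φ T _ _)) ≫
        MonoidalMonad.φ T _ _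
    have h1 : (((f₁.of ⊗ₘ f₂.of) ≫ MonoidalMonad.φ T _ _) ⊗ₘ f₃.of) =
        ((f₁.of ⊗ₘ f₂.of) ⊗ₘ f₃.of) ≫ MonoidalMonad.φ T Y₁.of Y₂.of ▷ T.obj Y₃.of := by
      rw [← tensorHom_id, MonoidalCategory.tensorHom_comp_tensorHom, Category.comp_id]
    have h2 : (f₁.of ⊗ₘ ((f₂.of ⊗ₘ f₃.of) ≫ MonoidalMonad.φ T _ _)) =
        (f₁.of ⊗ₘ (f₂.of ⊗ₘ f₃.of)) ≫ T.obj Y₁.of ◁ MonoidalMonad.φ T Y₂.of Y₃.of := by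
      rw [← id_tensorHom, MonoidalCategory.tensorHom_comp_tensorHom, Category.comp_id]
    rw [h1, h2]
    simp only [Category.assoc, Functor.LaxMonoidal.associativity]
    simp only [MonoidalCategory.associator_naturality_assoc]
  · intro X Y f
    apply Kleisli.hom_ext
    refine (hK _ _).trans (Eq.trans ?_ (hK' _ _).symm)
    change ((T.η.app _ ⊗ₘ f.of) ≫ MonoidalMonad.φ T _ _) ≫ T.map (λ_ _).hom = (λ_ _).hom ≫ f.of
    rw [← MonoidalMonad.ε_eq, ← MonoidalCategory.leftUnitor_naturality,
      Functor.LaxMonoidal.left_unitality, MonoidalCategory.tensorHom_def']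
    simp
  · intro X Y f
    apply Kleisli.hom_ext
    refine (hK _ _).trans (Eq.trans ?_ (hK' _ _).symm)
    change ((f.of ⊗ₘ T.η.app _) ≫ MonoidalMonad.φ T _ _) ≫ T.map (ρ_ _).hom = (ρ_ _).hom ≫ f.of
    rw [← MonoidalMonad.ε_eq, ← MonoidalCategory.rightUnitor_naturality,
      Functor.LaxMonoidal.right_unitality, MonoidalCategory.tensorHom_def]
    simp
  · intro W X Y Z
    rw [hKid W, hKid Z]
    change ((Kleisli.Adjunction.toKleisli T).map _ ⊗ₘ (Kleisli.Adjunction.toKleisli T).map _) ≫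
      (Kleisli.Adjunction.toKleisli T).map _ ≫
      ((Kleisli.Adjunction.toKleisli T).map _ ⊗ₘ (Kleisli.Adjunction.toKleisli T).map _) =
      (Kleisli.Adjunction.toKleisli T).map _ ≫ (Kleisli.Adjunction.toKleisli T).map _
    rw [hKt, hKt]
    refine (congrArg _ ((Kleisli.Adjunction.toKleisli T).map_comp _ _).symm).trans
      (((Kleisli.Adjunction.toKleisli T).map_comp _ _).symm.trans
      (Eq.trans ?_ ((Kleisli.Adjunction.toKleisli T).map_comp _ _)))
    refine congrArg _ ?_
    rw [tensorHom_id, id_tensorHom]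
    exact MonoidalCategory.pentagon W.of X.of Y.of Z.of
  · intro X Y
    rw [hKid X, hKid Y]
    change (Kleisli.Adjunction.toKleisli T).map _ ≫
      ((Kleisli.Adjunction.toKleisli T).map _ ⊗ₘ (Kleisli.Adjunction.toKleisli T).map _) =
      ((Kleisli.Adjunction.toKleisli T).map _ ⊗ₘ (Kleisli.Adjunction.toKleisli T).map _)
    rw [hKt, hKt]
    refine ((Kleisli.Adjunction.toKleisli T).map_comp _ _).symm.trans (congrArg _ ?_)
    rw [tensorHom_id, id_tensorHom]
    exact MonoidalCategory.triangle X.of Y.of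

end Monads

/-! ### Opmonoidal comonads and their Kleisli categories -/

section Comonads

variable {C : Type u} [Category.{v} C] [MonoidalCategory C]

open Functor.OplaxMonoidal in
/-- An opmonoidal natural transformation between opmonoidal functors. -/
class IsOpmonoidal {F F' : C ⥤ C} [F.OplaxMonoidal] [F'.OplaxMonoidal] (θ : F ⟶ F') : Prop where
  unit : θ.app (𝟙_ C) ≫ η F' = η F
  tensor (X Y : C) : θ.app (X ⊗ Y) ≫ δ F' X Y = δ F X Y ≫ (θ.app X ⊗ₘ θ.app Y)

/-- Opmonoidal structure on a comonad: the underlying functor is opmonoidal, and the counit and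
the comultiplication are opmonoidal natural transformations. -/
class OpmonoidalComonad (U : Comonad C) extends U.toFunctor.OplaxMonoidal where
  isOpmonoidal_ε : IsOpmonoidal U.ε
  isOpmonoidal_δ : IsOpmonoidal U.δ

/-- The tensor constraint `U (X ⊗ Y) ⟶ U X ⊗ U Y` of an opmonoidal comonad. -/
abbrev OpmonoidalComonad.ψ (U : Comonad C) [OpmonoidalComonad U] (X Y : C) :
    U.obj (X ⊗ Y) ⟶ U.obj X ⊗ U.obj Y :=
  Functor.OplaxMonoidal.δ U.toFunctor X Y

/-- The data of the tensor product on the Kleisli category of an opmonoidal comonad: on objects it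
is that of `C`, on morphisms it sends `f : U X ⟶ Y` and `f' : U X' ⟶ Y'` to
`U (X ⊗ X') ⟶ U X ⊗ U X' ⟶ Y ⊗ Y'`, and the constraints come from `C` along
`C ⥤ Cokleisli U`. -/
abbrev cokleisliMonoidalStruct (U : Comonad C) [OpmonoidalComonad U] :
    MonoidalCategoryStruct (Cokleisli U) where
  tensorObj X Y := .mk U (X.of ⊗ Y.of)
  tensorUnit := .mk U (𝟙_ C)
  tensorHom {X _ X' _} f g := .mk (OpmonoidalComonad.ψ U X.of X'.of ≫ (f.of ⊗ₘ g.of))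
  whiskerLeft X X' _ g := .mk (OpmonoidalComonad.ψ U X.of X'.of ≫ (U.ε.app X.of ⊗ₘ g.of))
  whiskerRight {X _} f X' := .mk (OpmonoidalComonad.ψ U X.of X'.of ≫ (f.of ⊗ₘ U.ε.app X'.of))
  associator X Y Z := (Cokleisli.Adjunction.toCokleisli U).mapIso (α_ X.of Y.of Z.of)
  leftUnitor X := (Cokleisli.Adjunction.toCokleisli U).mapIso (λ_ X.of)
  rightUnitor X := (Cokleisli.Adjunction.toCokleisli U).mapIso (ρ_ X.of)

end Comonads

/-! ### Mixed opwreaths -/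

section Opwreaths

variable {C : Type u} [Category.{v} C]

/-- The data of a mixed opwreath around a monad `T`. -/
structure MixedOpwreathData (T : CategoryTheory.Monad C) where
  G : C ⥤ C
  /-- `G T ⟹ T G` -/
  ζ : T.toFunctor ⋙ G ⟶ G ⋙ T.toFunctor
  /-- `G ⟹ T G G` -/
  δ : G ⟶ (G ⋙ G) ⋙ T.toFunctor
  /-- `G ⟹ T` -/
  ε : G ⟶ T.toFunctor

/-- The seven axioms of a mixed opwreath. The first two say that `(G, ζ)` is an endomorphism of
`(C, T)` in the Kleisli completion of the 2-category of categories, the next two that `ε` and `δ`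
are 2-cells there, and the last three that these are a counital coassociative comultiplication. -/
structure MixedOpwreathData.IsMixedOpwreath {T : CategoryTheory.Monad C}
    (D : MixedOpwreathData T) : Prop where
  ζ_mul (X : C) : D.G.map (T.μ.app X) ≫ D.ζ.app X =
    D.ζ.app (T.obj X) ≫ T.map (D.ζ.app X) ≫ T.μ.app (D.G.obj X)
  ζ_unit (X : C) : D.G.map (T.η.app X) ≫ D.ζ.app X = T.η.app (D.G.obj X)
  ε_ζ (X : C) : D.ε.app (T.obj X) ≫ T.μ.app X = D.ζ.app X ≫ T.map (D.ε.app X) ≫ T.μ.app X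
  δ_ζ (X : C) :
    D.δ.app (T.obj X) ≫ T.map (D.G.map (D.ζ.app X)) ≫ T.map (D.ζ.app (D.G.obj X)) ≫
        T.μ.app (D.G.obj (D.G.obj X)) =
      D.ζ.app X ≫ T.map (D.δ.app X) ≫ T.μ.app (D.G.obj (D.G.obj X))
  coassoc (X : C) :
    D.δ.app X ≫ T.map (D.δ.app (D.G.obj X)) ≫ T.μ.app (D.G.obj (D.G.obj (D.G.obj X))) =
      D.δ.app X ≫ T.map (D.G.map (D.δ.app X)) ≫ T.map (D.ζ.app (D.G.obj (D.G.obj X))) ≫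
        T.μ.app (D.G.obj (D.G.obj (D.G.obj X)))
  counit_left (X : C) :
    D.δ.app X ≫ T.map (D.ε.app (D.G.obj X)) ≫ T.μ.app (D.G.obj X) = T.η.app (D.G.obj X)
  counit_right (X : C) :
    D.δ.app X ≫ T.map (D.G.map (D.ε.app X)) ≫ T.map (D.ζ.app X) ≫ T.μ.app (D.G.obj X) =
      T.η.app (D.G.obj X)

/-- A mixed opwreath around the monad `T`. -/
structure MixedOpwreath (T : CategoryTheory.Monad C) extends MixedOpwreathData T where
  isMixedOpwreath : toMixedOpwreathData.IsMixedOpwreath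

namespace MixedOpwreath

variable {T : CategoryTheory.Monad C} (W : MixedOpwreath T)

/-- The comonad on the Kleisli category of `T` obtained by lifting `G` along `ζ`; it sends
`f : X ⟶ T Y` to `G X ⟶ G T Y ⟶ T G Y`. -/
def liftedComonad : Comonad (Kleisli T) where
  obj X := .mk T (W.G.obj X.of)
  map {_ Y} f := .mk (W.G.map f.of ≫ W.ζ.app Y.of)
  map_id X := Kleisli.hom_ext (W.isMixedOpwreath.ζ_unit X.of)
  map_comp {X Y Z} f g := by
    apply Kleisli.hom_ext
    change W.G.map (f.of ≫ T.map g.of ≫ T.μ.app Z.of) ≫ W.ζ.app Z.of =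
      (W.G.map f.of ≫ W.ζ.app Y.of) ≫ T.map (W.G.map g.of ≫ W.ζ.app Z.of) ≫ T.μ.app _
    have h := W.ζ.naturality g.of
    dsimp at h
    simp only [Functor.map_comp, Category.assoc, W.isMixedOpwreath.ζ_mul, reassoc_of% h]
  ε :=
    { app := fun X => .mk (W.ε.app X.of)
      naturality := fun X Y f => by
        apply Kleisli.hom_ext
        change (W.G.map f.of ≫ W.ζ.app Y.of) ≫ T.map (W.ε.app Y.of) ≫ T.μ.app _ =
          W.ε.app X.of ≫ T.map f.of ≫ T.μ.app _
        rw [Category.assoc, ← W.isMixedOpwreath.ε_ζ, NatTrans.naturality_assoc] }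
  δ :=
    { app := fun X => .mk (W.δ.app X.of)
      naturality := fun X Y f => by
        apply Kleisli.hom_ext
        change (W.G.map f.of ≫ W.ζ.app Y.of) ≫ T.map (W.δ.app Y.of) ≫
            T.μ.app (W.G.obj (W.G.obj Y.of)) =
          W.δ.app X.of ≫ T.map (W.G.map (W.G.map f.of ≫ W.ζ.app Y.of) ≫ W.ζ.app _) ≫ T.μ.app _
        have h := W.δ.naturality f.of
        dsimp at h
        rw [Category.assoc, ← W.isMixedOpwreath.δ_ζ, reassoc_of% h]
        simp }
  coassoc X := by
    apply Kleisli.hom_ext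
    change W.δ.app X.of ≫ T.map (W.G.map (W.δ.app X.of) ≫ W.ζ.app (W.G.obj (W.G.obj X.of))) ≫
        T.μ.app (W.G.obj (W.G.obj (W.G.obj X.of))) =
      W.δ.app X.of ≫ T.map (W.δ.app (W.G.obj X.of)) ≫ T.μ.app (W.G.obj (W.G.obj (W.G.obj X.of)))
    rw [W.isMixedOpwreath.coassoc]
    simp
  left_counit X := by
    apply Kleisli.hom_ext
    exact W.isMixedOpwreath.counit_left X.of
  right_counit X := by
    apply Kleisli.hom_ext
    change W.δ.app X.of ≫ T.map (W.G.map (W.ε.app X.of) ≫ W.ζ.app _) ≫ T.μ.app _ = T.η.app _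
    rw [← W.isMixedOpwreath.counit_right]
    simp

/-- The mixed Kleisli category of a mixed opwreath: the Kleisli category of the lifted comonad on
the Kleisli category of `T`. Its morphisms from `X` to `Y` are the morphisms `G X ⟶ T Y`. -/
abbrev Mkl := Cokleisli W.liftedComonad

variable [MonoidalCategory C] [MonoidalMonad T]

/-- Opmonoidal structure on a mixed opwreath around a monoidal monad is opmonoidal structure on the
lifted comonad. -/
abbrev Opmonoidal := OpmonoidalComonad W.liftedComonad

/-- The morphisms `ψ : G (X ⊗ Y) ⟶ T (G X ⊗ G Y)` underlying the tensor constraints of an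
opmonoidal mixed opwreath. -/
abbrev Opmonoidal.ψ {W : MixedOpwreath T} (O : W.Opmonoidal) (X Y : C) :
    W.G.obj (X ⊗ Y) ⟶ T.obj (W.G.obj X ⊗ W.G.obj Y) :=
  (OpmonoidalComonad.ψ W.liftedComonad (Kleisli.mk T X) (Kleisli.mk T Y)).of

end MixedOpwreath

end Opwreaths

/-! ### The monad given by tensoring with a monoid -/

section TensorMonad

variable {V : Type u} [Category.{v} V] [MonoidalCategory V]

/-- The monad `A ⊗ -` given by a monoid `A`. -/
def tensorMonad (A : V) [MonObj A] : CategoryTheory.Monad V where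
  toFunctor := tensorLeft A
  η := { app := fun X => (λ_ X).inv ≫ MonObj.one (X := A) ▷ X
         naturality := fun X Y f => by
          change f ≫ (λ_ Y).inv ≫ _ = ((λ_ X).inv ≫ _) ≫ A ◁ f
          rw [Category.assoc, ← whisker_exchange, leftUnitor_inv_naturality_assoc] }
  μ := { app := fun X => (α_ A A X).inv ≫ MonObj.mul (X := A) ▷ X
         naturality := fun X Y f => by
          change A ◁ A ◁ f ≫ (α_ A A Y).inv ≫ _ = ((α_ A A X).inv ≫ _) ≫ A ◁ f
          rw [Category.assoc, ← whisker_exchange, associator_inv_naturality_right_assoc] }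
  assoc X := by
    change A ◁ ((α_ A A X).inv ≫ MonObj.mul (X := A) ▷ X) ≫ (α_ A A X).inv ≫
        MonObj.mul (X := A) ▷ X =
      ((α_ A A (A ⊗ X)).inv ≫ MonObj.mul (X := A) ▷ (A ⊗ X)) ≫ (α_ A A X).inv ≫
        MonObj.mul (X := A) ▷ X
    have h := congrArg (fun f => (α_ A A (A ⊗ X)).inv ≫ (α_ (A ⊗ A) A X).inv ≫ f ▷ X)
      (MonObj.mul_assoc A)
    simp only [comp_whiskerRight] at h
    simpa using h.symm
  left_unit X := by
    change ((λ_ (A ⊗ X)).inv ≫ MonObj.one (X := A) ▷ (A ⊗ X)) ≫ (α_ A A X).inv ≫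
        MonObj.mul (X := A) ▷ X = 𝟙 (A ⊗ X)
    have h := congrArg (fun f => (λ_ (A ⊗ X)).inv ≫ (α_ _ A X).inv ≫ f ▷ X) (MonObj.one_mul A)
    simp only [comp_whiskerRight] at h
    simpa using h
  right_unit X := by
    change A ◁ ((λ_ X).inv ≫ MonObj.one (X := A) ▷ X) ≫ (α_ A A X).inv ≫
        MonObj.mul (X := A) ▷ X = 𝟙 (A ⊗ X)
    have h := congrArg (fun f => A ◁ (λ_ X).inv ≫ (α_ A _ X).inv ≫ f ▷ X) (MonObj.mul_one A)
    simp only [comp_whiskerRight] at h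
    simpa using h

variable [BraidedCategory V]

/-- The morphism `(A ⊗ X) ⊗ (A ⊗ Y) ⟶ (A ⊗ A) ⊗ (X ⊗ Y) ⟶ A ⊗ (X ⊗ Y)`, where the first
arrow is the braiding `X ⊗ A ⟶ A ⊗ X` of the middle factors. -/
def tensorφ (A : V) [MonObj A] (X Y : V) : (A ⊗ X) ⊗ (A ⊗ Y) ⟶ A ⊗ (X ⊗ Y) :=
  tensorμ A X A Y ≫ MonObj.mul (X := A) ▷ (X ⊗ Y)

lemma tensorφ_natural_left (A : V) [MonObj A] {X Y : V} (f : X ⟶ Y) (X' : V) :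
    (A ◁ f) ▷ (A ⊗ X') ≫ tensorφ A Y X' = tensorφ A X X' ≫ A ◁ (f ▷ X') := by
  have h := tensorμ_natural_left (𝟙 A) f A X'
  rw [id_tensorHom] at h
  rw [tensorφ, reassoc_of% h, tensorφ, Category.assoc, ← whisker_exchange]
  simp

lemma tensorφ_natural_right (A : V) [MonObj A] (X' : V) {X Y : V} (f : X ⟶ Y) :
    (A ⊗ X') ◁ (A ◁ f) ≫ tensorφ A X' Y = tensorφ A X' X ≫ A ◁ (X' ◁ f) := by
  have h := tensorμ_natural_right A X' (𝟙 A) f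
  rw [id_tensorHom] at h
  rw [tensorφ, reassoc_of% h, tensorφ, Category.assoc, ← whisker_exchange]
  simp

lemma tensorφ_associativity (A : V) [MonObj A] (X Y Z : V) :
    tensorφ A X Y ▷ (A ⊗ Z) ≫ tensorφ A (X ⊗ Y) Z ≫ A ◁ (α_ X Y Z).hom =
      (α_ (A ⊗ X) (A ⊗ Y) (A ⊗ Z)).hom ≫ (A ⊗ X) ◁ tensorφ A Y Z ≫ tensorφ A X (Y ⊗ Z) := by
  have h1 := tensorμ_natural_left (MonObj.mul (X := A)) (𝟙 (X ⊗ Y)) A Z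
  have h2 := tensorμ_natural_right A X (MonObj.mul (X := A)) (𝟙 (Y ⊗ Z))
  have h3 := tensor_associativity A X A Y A Z
  rw [tensorHom_id] at h1 h2
  simp only [tensorφ, comp_whiskerRight, Category.assoc, whiskerLeft_comp]
  rw [reassoc_of% h1, reassoc_of% h2, ← reassoc_of% h3]
  refine whisker_eq _ (whisker_eq _ ?_)
  simp only [← tensorHom_id, ← id_tensorHom, MonoidalCategory.tensorHom_comp_tensorHom,
    Category.id_comp, Category.comp_id]
  have h4 := MonObj.mul_assoc A
  rw [← tensorHom_id, ← id_tensorHom] at h4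
  rw [h4, id_tensorHom_id, id_tensorHom_id, Category.id_comp, Category.comp_id]

lemma tensorφ_left_unitality (A : V) [MonObj A] (X : V) :
    (λ_ (A ⊗ X)).hom = ((λ_ (𝟙_ V)).inv ≫ MonObj.one (X := A) ▷ 𝟙_ V) ▷ (A ⊗ X) ≫
      tensorφ A (𝟙_ V) X ≫ A ◁ (λ_ X).hom := by
  have h1 := tensorμ_natural_left (MonObj.one (X := A)) (𝟙 (𝟙_ V)) A X
  rw [tensorHom_id] at h1
  rw [tensor_left_unitality, tensorφ, comp_whiskerRight, Category.assoc, Category.assoc,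
    reassoc_of% h1]
  refine whisker_eq _ (whisker_eq _ ?_)
  have h2 := MonObj.one_mul A
  simp only [← tensorHom_id, ← id_tensorHom, MonoidalCategory.tensorHom_comp_tensorHom,
    Category.id_comp, Category.comp_id] at h2 ⊢
  rw [h2, id_tensorHom_id, Category.id_comp]

lemma tensorφ_right_unitality (A : V) [MonObj A] (X : V) :
    (ρ_ (A ⊗ X)).hom = (A ⊗ X) ◁ ((λ_ (𝟙_ V)).inv ≫ MonObj.one (X := A) ▷ 𝟙_ V) ≫
      tensorφ A X (𝟙_ V) ≫ A ◁ (ρ_ X).hom := by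
  have h1 := tensorμ_natural_right A X (MonObj.one (X := A)) (𝟙 (𝟙_ V))
  rw [tensorHom_id] at h1
  rw [tensor_right_unitality, tensorφ, whiskerLeft_comp, Category.assoc, Category.assoc,
    reassoc_of% h1]
  refine whisker_eq _ (whisker_eq _ ?_)
  have h2 := MonObj.mul_one A
  simp only [← tensorHom_id, ← id_tensorHom, MonoidalCategory.tensorHom_comp_tensorHom,
    Category.id_comp, Category.comp_id] at h2 ⊢
  rw [h2, id_tensorHom_id, Category.id_comp]

lemma tensorφ_unit (A : V) [MonObj A] (X Y : V) :
    ((λ_ X).inv ≫ MonObj.one (X := A) ▷ X ⊗ₘ (λ_ Y).inv ≫ MonObj.one (X := A) ▷ Y) ≫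
      tensorφ A X Y = (λ_ (X ⊗ Y)).inv ≫ MonObj.one (X := A) ▷ (X ⊗ Y) := by
  have h1 := tensorμ_natural (MonObj.one (X := A)) (𝟙 X) (MonObj.one (X := A)) (𝟙 Y)
  have h2 := leftUnitor_monoidal X Y
  have h3 : ((λ_ X).inv ⊗ₘ (λ_ Y).inv) ≫ tensorμ (𝟙_ V) X (𝟙_ V) Y =
      (λ_ (X ⊗ Y)).inv ≫ (λ_ (𝟙_ V)).inv ▷ (X ⊗ Y) := by
    rw [← cancel_mono ((λ_ (𝟙_ V)).hom ▷ (X ⊗ Y) ≫ (λ_ (X ⊗ Y)).hom), Category.assoc, ← h2]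
    simp
  have h4 : (λ_ (𝟙_ V)).inv ≫ (MonObj.one (X := A) ⊗ₘ MonObj.one) ≫ MonObj.mul =
      MonObj.one (X := A) := by
    rw [MonoidalCategory.tensorHom_def', Category.assoc, MonObj.one_mul]
    simp
  rw [tensorHom_id, tensorHom_id] at h1
  rw [← MonoidalCategory.tensorHom_comp_tensorHom, tensorφ, Category.assoc, reassoc_of% h1,
    reassoc_of% h3]
  rw [id_tensorHom_id, tensorHom_id, ← comp_whiskerRight, ← comp_whiskerRight, h4]

lemma tensorφ_mul (A : V) [MonObj A] [IsCommMonObj A] (X Y : V) :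
    ((α_ A A X).inv ≫ MonObj.mul (X := A) ▷ X ⊗ₘ (α_ A A Y).inv ≫ MonObj.mul (X := A) ▷ Y) ≫
      tensorφ A X Y = tensorφ A (A ⊗ X) (A ⊗ Y) ≫ A ◁ tensorφ A X Y ≫ (α_ A A (X ⊗ Y)).inv ≫
        MonObj.mul (X := A) ▷ (X ⊗ Y) := by
  have h1 := tensorμ_natural (MonObj.mul (X := A)) (𝟙 X) (MonObj.mul (X := A)) (𝟙 Y)
  have h2 := associator_monoidal A A X A A Y
  have h3 := MonObj.mul_mul_mul_comm A
  have h4 : ((α_ A A X).inv ⊗ₘ (α_ A A Y).inv) ≫ tensorμ (A ⊗ A) X (A ⊗ A) Y ≫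
      tensorμ A A A A ▷ (X ⊗ Y) = tensorμ A (A ⊗ X) A (A ⊗ Y) ≫ (A ⊗ A) ◁ tensorμ A X A Y ≫
        (α_ (A ⊗ A) (A ⊗ A) (X ⊗ Y)).inv := by
    rw [← cancel_mono (α_ (A ⊗ A) (A ⊗ A) (X ⊗ Y)).hom]
    simp only [Category.assoc, h2, Iso.inv_hom_id, Category.comp_id]
    rw [MonoidalCategory.tensorHom_comp_tensorHom_assoc]
    simp
  rw [tensorHom_id, tensorHom_id] at h1
  rw [← MonoidalCategory.tensorHom_comp_tensorHom]
  simp only [tensorφ, Category.assoc]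
  rw [reassoc_of% h1, id_tensorHom_id, tensorHom_id, ← comp_whiskerRight, ← h3, comp_whiskerRight,
    reassoc_of% h4]
  refine whisker_eq _ ?_
  rw [whiskerLeft_comp, Category.assoc, ← whisker_exchange_assoc, ← whisker_exchange_assoc,
    MonoidalCategory.tensorHom_def']
  monoidal

instance tensorLaxMonoidal (A : V) [MonObj A] : (tensorMonad A).toFunctor.LaxMonoidal where
  ε := (λ_ (𝟙_ V)).inv ≫ MonObj.one (X := A) ▷ 𝟙_ V
  μ X Y := tensorφ A X Y
  μ_natural_left f X' := tensorφ_natural_left A f X'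
  μ_natural_right X' f := tensorφ_natural_right A X' f
  associativity X Y Z := tensorφ_associativity A X Y Z
  left_unitality X := tensorφ_left_unitality A X
  right_unitality X := tensorφ_right_unitality A X

/-- For a commutative monoid `A`, the monad `A ⊗ -` is monoidal. -/
instance tensorMonoidalMonad (A : V) [MonObj A] [IsCommMonObj A] :
    MonoidalMonad (tensorMonad A) where
  isMonoidal_η :=
    { unit := Category.id_comp _
      tensor := fun X Y => (Category.id_comp _).trans (tensorφ_unit A X Y).symm }
  isMonoidal_μ :=
    { unit := by
        change (((λ_ (𝟙_ V)).inv ≫ MonObj.one (X := A) ▷ 𝟙_ V) ≫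
          A ◁ ((λ_ (𝟙_ V)).inv ≫ MonObj.one (X := A) ▷ 𝟙_ V)) ≫
          (α_ A A (𝟙_ V)).inv ≫ MonObj.mul (X := A) ▷ 𝟙_ V =
            (λ_ (𝟙_ V)).inv ≫ MonObj.one (X := A) ▷ 𝟙_ V
        have h := (tensorMonad A).right_unit (𝟙_ V)
        change A ◁ ((λ_ (𝟙_ V)).inv ≫ MonObj.one (X := A) ▷ 𝟙_ V) ≫ (α_ A A (𝟙_ V)).inv ≫
          MonObj.mul (X := A) ▷ 𝟙_ V = 𝟙 (A ⊗ 𝟙_ V) at h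
        rw [Category.assoc, h, Category.comp_id]
      tensor := fun X Y => by
        refine Eq.trans ?_ (tensorφ_mul A X Y).symm
        exact Category.assoc _ _ _ }

end TensorMonad

/-! ### Twisted coactions -/

section TwistedCoactions

open scoped MonObj ComonObj

variable {V : Type u} [Category.{v} V] [MonoidalCategory V]

/-- The product `u • v : X ⊗ Y ⟶ M` of two morphisms `u : X ⟶ M` and `v : Y ⟶ M` into a monoid. -/
def dot {X Y M : V} [MonObj M] (u : X ⟶ M) (v : Y ⟶ M) : X ⊗ Y ⟶ M :=
  (u ⊗ₘ v) ≫ μ[M]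

variable [BraidedCategory V]

/-- A twisted (right) coaction of a bimonoid `B` on a monoid `A`. Tensor products of monoids carry
the monoid structure given by the braiding, iterated tensor products are bracketed to the right. -/
structure TwistedCoaction (A B : V) [MonObj A] [BimonObj B] where
  /-- the morphism `γ` -/
  coact : A ⟶ A ⊗ B
  /-- the 2-cocycle -/
  τ : 𝟙_ V ⟶ A ⊗ (B ⊗ B)
  isMonHom_coact : IsMonHom coact
  counitality : coact ≫ A ◁ ε[B] ≫ (ρ_ A).hom = 𝟙 A
  coassociativity :
    (λ_ A).inv ≫ dot τ (coact ≫ coact ▷ B ≫ (α_ A B B).hom) = (ρ_ A).inv ≫ dot (coact ≫ A ◁ Δ[B]) τ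
  cocyclicity :
    dot (τ ≫ A ◁ (Δ[B] ▷ B) ≫ A ◁ (α_ B B B).hom)
        ((ρ_ (𝟙_ V)).inv ≫ (τ ⊗ₘ η[B]) ≫ (α_ A (B ⊗ B) B).hom ≫ A ◁ (α_ B B B).hom) =
      dot (τ ≫ A ◁ (B ◁ Δ[B])) (τ ≫ coact ▷ (B ⊗ B) ≫ (α_ A B (B ⊗ B)).hom)
  normality_right :
    τ ≫ A ◁ (B ◁ ε[B]) ≫ A ◁ (ρ_ B).hom = (ρ_ (𝟙_ V)).inv ≫ (η[A] ⊗ₘ η[B])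
  normality_left :
    τ ≫ A ◁ (ε[B] ▷ B) ≫ A ◁ (λ_ B).hom = (ρ_ (𝟙_ V)).inv ≫ (η[A] ⊗ₘ η[B])

namespace TwistedCoaction

variable {A B : V} [MonObj A] [BimonObj B] (c : TwistedCoaction A B)

/-- `ζ = (η_A ⊗ 1_B) • γ`. -/
def zeta : B ⊗ A ⟶ A ⊗ B := dot ((λ_ B).inv ≫ η[A] ▷ B) c.coact

/-- `δ = (η_A ⊗ δ_B) • τ`. -/
def delta : B ⟶ A ⊗ (B ⊗ B) := (ρ_ B).inv ≫ dot ((λ_ B).inv ≫ (η[A] ⊗ₘ Δ[B])) c.τ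

/-- `ε = η_A ∘ ε_B`. -/
def eps (_ : TwistedCoaction A B) : B ⟶ A := ε[B] ≫ η[A]

/-- The data of the mixed opwreath around the monad `A ⊗ -` given by a twisted coaction: the
endofunctor is `B ⊗ -`, and `ζ`, `δ`, `ε` are obtained from those above by tensoring with `X`. -/
def opwreathData : MixedOpwreathData (tensorMonad A) :=
  ⟨tensorLeft B,
    { app := fun X => (α_ B A X).inv ≫ c.zeta ▷ X ≫ (α_ A B X).hom
      naturality := fun X Y f => by
        change B ◁ (A ◁ f) ≫ (α_ B A Y).inv ≫ c.zeta ▷ Y ≫ (α_ A B Y).hom =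
          ((α_ B A X).inv ≫ c.zeta ▷ X ≫ (α_ A B X).hom) ≫ A ◁ (B ◁ f)
        rw [associator_inv_naturality_right_assoc, whisker_exchange_assoc]
        simp },
    { app := fun X => c.delta ▷ X ≫ (α_ A (B ⊗ B) X).hom ≫ A ◁ (α_ B B X).hom
      naturality := fun X Y f => by
        change B ◁ f ≫ c.delta ▷ Y ≫ (α_ A (B ⊗ B) Y).hom ≫ A ◁ (α_ B B Y).hom =
          (c.delta ▷ X ≫ (α_ A (B ⊗ B) X).hom ≫ A ◁ (α_ B B X).hom) ≫ A ◁ (B ◁ (B ◁ f))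
        simp [whisker_exchange_assoc] },
    { app := fun X => c.eps ▷ X
      naturality := fun X Y f => by
        change B ◁ f ≫ c.eps ▷ Y = c.eps ▷ X ≫ A ◁ f
        rw [whisker_exchange] }⟩

end TwistedCoaction

/-- A monoidal twisted coaction of a bimonoid `B` on a monoid `A`: a twisted coaction together with
a morphism `𝔡 : B ⟶ A ⊗ B ⊗ B` satisfying the five conditions below. The composition `⊗≫` inserts
the associators and unitors that are needed. -/
structure MonoidalTwistedCoaction (A B : V) [MonObj A] [BimonObj B] extends
    TwistedCoaction A B where
  𝔡 : B ⟶ A ⊗ (B ⊗ B)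
  /-- An equation between morphisms `B ⊗ A ⊗ A ⟶ A ⊗ B ⊗ B`. -/
  𝔡_coact :
    𝔡 ▷ (A ⊗ A) ⊗≫ (A ⊗ B) ◁ (β_ A B).inv ▷ A ⊗≫
        A ◁ (toTwistedCoaction.zeta ⊗ₘ toTwistedCoaction.zeta) ⊗≫
        (A ⊗ A) ◁ (β_ B A).hom ▷ B ⊗≫ (μ[A] ▷ A ≫ μ[A]) ▷ (B ⊗ B) =
      B ◁ μ[A] ≫ toTwistedCoaction.zeta ≫ A ◁ 𝔡 ⊗≫ μ[A] ▷ (B ⊗ B)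
  /-- An equation between morphisms `B ⟶ A ⊗ B ⊗ B ⊗ B`. -/
  𝔡_𝔡 :
    𝔡 ⊗≫ A ◁ 𝔡 ▷ B ⊗≫ μ[A] ▷ (B ⊗ (B ⊗ B)) =
      𝔡 ⊗≫ (A ⊗ B) ◁ 𝔡 ⊗≫ A ◁ (β_ B A).hom ▷ (B ⊗ B) ⊗≫ μ[A] ▷ (B ⊗ (B ⊗ B))
  𝔡_counit_right : 𝔡 ≫ A ◁ (B ◁ ε[B]) ≫ A ◁ (ρ_ B).hom = (λ_ B).inv ≫ η[A] ▷ B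
  𝔡_counit_left : 𝔡 ≫ A ◁ (ε[B] ▷ B) ≫ A ◁ (λ_ B).hom = (λ_ B).inv ≫ η[A] ▷ B
  /-- An equation between morphisms `B ⟶ A ⊗ B ⊗ B ⊗ B ⊗ B`. -/
  𝔡_δ :
    𝔡 ⊗≫ A ◁ (toTwistedCoaction.delta ⊗ₘ toTwistedCoaction.delta) ⊗≫
        (A ⊗ A) ◁ (β_ (B ⊗ B) A).hom ▷ (B ⊗ B) ⊗≫
        (μ[A] ▷ A ≫ μ[A]) ▷ (B ⊗ (B ⊗ (B ⊗ B))) =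
      toTwistedCoaction.delta ⊗≫ (A ⊗ B) ◁ 𝔡 ⊗≫
        A ◁ toTwistedCoaction.zeta ▷ (B ⊗ B) ⊗≫ (A ⊗ A) ◁ 𝔡 ▷ (B ⊗ B) ⊗≫
        (μ[A] ▷ A ≫ μ[A]) ▷ (B ⊗ (B ⊗ (B ⊗ B))) ⊗≫
        (A ⊗ B) ◁ (β_ B B).inv ▷ B ⊗≫ 𝟙 (A ⊗ (B ⊗ (B ⊗ (B ⊗ B))))

/-- `ψ = (1_A ⊗ 1_B ⊗ c⁻¹ ⊗ 1) ∘ (𝔡 ⊗ 1 ⊗ 1) : B ⊗ X ⊗ X' ⟶ A ⊗ B ⊗ X ⊗ B ⊗ X'`, where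
`c⁻¹ : B ⊗ X ⟶ X ⊗ B` is the inverse of the braiding `X ⊗ B ⟶ B ⊗ X`. -/
def MonoidalTwistedCoaction.psi {A B : V} [MonObj A] [BimonObj B]
    (c : MonoidalTwistedCoaction A B) (X X' : V) :
    B ⊗ (X ⊗ X') ⟶ A ⊗ ((B ⊗ X) ⊗ (B ⊗ X')) :=
  c.𝔡 ▷ (X ⊗ X') ⊗≫ (A ⊗ B) ◁ (β_ X B).inv ▷ X' ⊗≫ 𝟙 (A ⊗ ((B ⊗ X) ⊗ (B ⊗ X')))

end TwistedCoactions

end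

end MixedWreath

/-! Two layers are independent. Formally, the Kleisli category of an opmonoidal comonad is monoidal:
the counit and comultiplication being opmonoidal is what makes the tensor of Kleisli morphisms
functorial, and the constraints are inherited along a functor that strictly preserves tensors
(`cokleisliMonoidal`). It remains to see that a monoidal twisted coaction yields such a comonad on
the Kleisli category of `A ⊗ -`.

For the opwreath axioms, everything is a product in one of the monoids `A ⊗ B ⊗ ⋯ ⊗ B`. By
`inl_dot`, the Kleisli multiplication `A ◁ m ≫ μ` is the product `inl • m`; moreover `inl • inr =
𝟙`, while `ζ = inr • γ` and `δ = (Δ ≫ inr) • τ`. Since `γ`, `Δ`, `ε` and the inclusions used are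
monoid morphisms, both sides of each nontrivial axiom expand into iterated products with a common
leading factor. What then differs is exactly the twisted coassociativity of `γ` (`delta_zeta`), the
cocycle condition (`delta_coassoc`) or a normality condition.

For `ψ`, each opmonoidality equation is one of the conditions on `𝔡`, tensored with the objects
involved and followed by inverse braidings of those objects past copies of `B`. The monoidal
structure of the monad braids objects past `A` by `c`; naturality of `c⁻¹` produces the inverse of
this crossing, which cancels it (`braiding_inv_comp_whiskerLeft_braiding`). This is why `ψ` uses
`c⁻¹`. The main equations are `psi_natural`, `psi_assoc`, `psi_eps` and `psi_delta`. -/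

open CategoryTheory MonoidalCategory

namespace MixedWreath

universe v u

/-! ### Monoidality of the Kleisli category of an opmonoidal comonad -/

section Cokleisli

variable {C : Type u} [Category.{v} C] [MonoidalCategory C]

open Functor.OplaxMonoidal

/-- The Kleisli category of an opmonoidal comonad is monoidal. -/
abbrev cokleisliMonoidal (U : Comonad C) [OpmonoidalComonad U] :
    MonoidalCategory (Cokleisli U) := by
  letI := cokleisliMonoidalStruct U
  have hε (X Y : C) : OpmonoidalComonad.ψ U X Y ≫ (U.ε.app X ⊗ₘ U.ε.app Y) = U.ε.app (X ⊗ Y) := by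
    have h := (OpmonoidalComonad.isOpmonoidal_ε (U := U)).tensor X Y
    simpa using h.symm
  have hδ (X Y : C) : U.δ.app (X ⊗ Y) ≫ U.map (OpmonoidalComonad.ψ U X Y) ≫
      OpmonoidalComonad.ψ U (U.obj X) (U.obj Y) =
      OpmonoidalComonad.ψ U X Y ≫ (U.δ.app X ⊗ₘ U.δ.app Y) := by
    have h := (OpmonoidalComonad.isOpmonoidal_δ (U := U)).tensor X Y
    simpa using h
  have hη : η U.toFunctor = U.ε.app (𝟙_ C) := by
    have h := (OpmonoidalComonad.isOpmonoidal_ε (U := U)).unit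
    simpa using h.symm
  have hK {X Y Z : C} (g : U.obj X ⟶ Y) (f : Y ⟶ Z) :
      U.δ.app X ≫ U.map g ≫ U.ε.app Y ≫ f = g ≫ f := by
    simp
  have hK' {X Y Z : C} (f : X ⟶ Y) (g : U.obj Y ⟶ Z) :
      U.δ.app X ≫ U.map (U.ε.app X ≫ f) ≫ g = U.map f ≫ g := by
    simp
  have hKt {X Y X' Y' : C} (f : X ⟶ Y) (f' : X' ⟶ Y') :
      (Cokleisli.Adjunction.toCokleisli U).map f ⊗ₘ (Cokleisli.Adjunction.toCokleisli U).map f' =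
        (Cokleisli.Adjunction.toCokleisli U).map (f ⊗ₘ f') := by
    apply Cokleisli.hom_ext
    change OpmonoidalComonad.ψ U X X' ≫ ((U.ε.app X ≫ f) ⊗ₘ (U.ε.app X' ≫ f')) =
      U.ε.app _ ≫ (f ⊗ₘ f')
    rw [← hε]
    simp
  have hKid (X : Cokleisli U) : 𝟙 X = (Cokleisli.Adjunction.toCokleisli U).map (𝟙 X.of) :=
    ((Cokleisli.Adjunction.toCokleisli U).map_id X.of).symm
  refine MonoidalCategory.ofTensorHom ?_ ?_ ?_ ?_ ?_ ?_ ?_ ?_ ?_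
  · intro X Y
    exact Cokleisli.hom_ext _ (hε _ _)
  · intros; rfl
  · intros; rfl
  · intro X₁ Y₁ Z₁ X₂ Y₂ Z₂ f₁ f₂ g₁ g₂
    apply Cokleisli.hom_ext
    change U.δ.app _ ≫ U.map (OpmonoidalComonad.ψ U _ _ ≫ (f₁.of ⊗ₘ f₂.of)) ≫
      OpmonoidalComonad.ψ U _ _ ≫ (g₁.of ⊗ₘ g₂.of) =
      OpmonoidalComonad.ψ U _ _ ≫
        ((U.δ.app _ ≫ U.map f₁.of ≫ g₁.of) ⊗ₘ (U.δ.app _ ≫ U.map f₂.of ≫ g₂.of))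
    -- Interchange: naturality of `ψ` moves `U f₁ ⊗ U f₂` across it, and `hδ` is then the
    -- compatibility with comultiplication.
    simp only [← tensorHom_comp_tensorHom, Category.assoc, Functor.map_comp]
    rw [← δ_natural_assoc, reassoc_of% hδ]
  · intro X₁ X₂ X₃ Y₁ Y₂ Y₃ f₁ f₂ f₃
    apply Cokleisli.hom_ext
    refine (hK _ _).trans (Eq.trans ?_ (hK' _ _).symm)
    change (OpmonoidalComonad.ψ U _ _ ≫ ((OpmonoidalComonad.ψ U _ _ ≫
        (f₁.of ⊗ₘ f₂.of)) ⊗ₘ f₃.of)) ≫ (α_ _ _ _).hom =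
      U.map (α_ _ _ _).hom ≫ OpmonoidalComonad.ψ U _ _ ≫
        (f₁.of ⊗ₘ (OpmonoidalComonad.ψ U _ _ ≫ (f₂.of ⊗ₘ f₃.of)))
    have h1 : ((OpmonoidalComonad.ψ U X₁.of X₂.of ≫ (f₁.of ⊗ₘ f₂.of)) ⊗ₘ f₃.of) =
        OpmonoidalComonad.ψ U X₁.of X₂.of ▷ U.obj X₃.of ≫ ((f₁.of ⊗ₘ f₂.of) ⊗ₘ f₃.of) := by
      rw [← tensorHom_id, MonoidalCategory.tensorHom_comp_tensorHom, Category.id_comp]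
    have h2 : (f₁.of ⊗ₘ (OpmonoidalComonad.ψ U X₂.of X₃.of ≫ (f₂.of ⊗ₘ f₃.of))) =
        U.obj X₁.of ◁ OpmonoidalComonad.ψ U X₂.of X₃.of ≫ (f₁.of ⊗ₘ (f₂.of ⊗ₘ f₃.of)) := by
      rw [← id_tensorHom, MonoidalCategory.tensorHom_comp_tensorHom, Category.id_comp]
    rw [h1, h2]
    have h3 := oplax_associativity U.toFunctor X₁.of X₂.of X₃.of
    simp only [Category.assoc, MonoidalCategory.associator_naturality]
    exact (reassoc_of% h3) _
  · intro X Y f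
    apply Cokleisli.hom_ext
    refine (hK _ _).trans (Eq.trans ?_ (hK' _ _).symm)
    change (OpmonoidalComonad.ψ U _ _ ≫ (U.ε.app _ ⊗ₘ f.of)) ≫ (λ_ _).hom = U.map (λ_ _).hom ≫ f.of
    -- Opmonoidality of the counit identifies `U.ε` at the unit with the unit constraint of `U`, so
    -- the unit axiom is the unitality of `U`.
    rw [← hη, MonoidalCategory.tensorHom_def]
    dsimp only [Functor.id_obj]
    have h := oplax_left_unitality U.toFunctor X.of
    rw [← cancel_epi (U.map (λ_ X.of).inv), Category.assoc, Category.assoc,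
      MonoidalCategory.leftUnitor_naturality, ← reassoc_of% h, ← Functor.map_comp_assoc]
    simp
  · intro X Y f
    apply Cokleisli.hom_ext
    refine (hK _ _).trans (Eq.trans ?_ (hK' _ _).symm)
    change (OpmonoidalComonad.ψ U _ _ ≫ (f.of ⊗ₘ U.ε.app _)) ≫ (ρ_ _).hom = U.map (ρ_ _).hom ≫ f.of
    rw [← hη, MonoidalCategory.tensorHom_def']
    dsimp only [Functor.id_obj]
    have h := oplax_right_unitality U.toFunctor X.of
    rw [← cancel_epi (U.map (ρ_ X.of).inv), Category.assoc, Category.assoc,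
      MonoidalCategory.rightUnitor_naturality, ← reassoc_of% h, ← Functor.map_comp_assoc]
    simp
  · intro W X Y Z
    -- All constraints come from `C`, and `hKt` says that `toCokleisli` preserves tensors; the
    -- pentagon is the image of that of `C`, as is the triangle below.
    rw [hKid W, hKid Z]
    change ((Cokleisli.Adjunction.toCokleisli U).map _ ⊗ₘ
        (Cokleisli.Adjunction.toCokleisli U).map _) ≫
      (Cokleisli.Adjunction.toCokleisli U).map _ ≫
      ((Cokleisli.Adjunction.toCokleisli U).map _ ⊗ₘ
        (Cokleisli.Adjunction.toCokleisli U).map _) =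
      (Cokleisli.Adjunction.toCokleisli U).map _ ≫ (Cokleisli.Adjunction.toCokleisli U).map _
    rw [hKt, hKt]
    refine (congrArg _ ((Cokleisli.Adjunction.toCokleisli U).map_comp _ _).symm).trans
      (((Cokleisli.Adjunction.toCokleisli U).map_comp _ _).symm.trans
      (Eq.trans ?_ ((Cokleisli.Adjunction.toCokleisli U).map_comp _ _)))
    refine congrArg _ ?_
    rw [tensorHom_id, id_tensorHom]
    exact MonoidalCategory.pentagon W.of X.of Y.of Z.of
  · intro X Y
    rw [hKid X, hKid Y]
    change (Cokleisli.Adjunction.toCokleisli U).map _ ≫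
      ((Cokleisli.Adjunction.toCokleisli U).map _ ⊗ₘ
        (Cokleisli.Adjunction.toCokleisli U).map _) =
      ((Cokleisli.Adjunction.toCokleisli U).map _ ⊗ₘ (Cokleisli.Adjunction.toCokleisli U).map _)
    rw [hKt, hKt]
    refine ((Cokleisli.Adjunction.toCokleisli U).map_comp _ _).symm.trans (congrArg _ ?_)
    rw [tensorHom_id, id_tensorHom]
    exact MonoidalCategory.triangle X.of Y.of

end Cokleisli

/-! ### Products of morphisms into a monoid -/

section Dot

open scoped MonObj ComonObj

variable {V : Type u} [Category.{v} V] [MonoidalCategory V]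

section Monoid

variable {X X' Y Z M N : V} [MonObj M] [MonObj N]

lemma comp_dot (f : X' ⟶ X) (u : X ⟶ M) (v : Y ⟶ M) : f ▷ Y ≫ dot u v = dot (f ≫ u) v := by
  simp [dot, ← tensorHom_id]

lemma whiskerLeft_dot (f : X' ⟶ Y) (u : X ⟶ M) (v : Y ⟶ M) :
    X ◁ f ≫ dot u v = dot u (f ≫ v) := by
  simp [dot, ← id_tensorHom]

lemma dot_assoc (u : X ⟶ M) (v : Y ⟶ M) (w : Z ⟶ M) :
    dot (dot u v) w = (α_ X Y Z).hom ≫ dot u (dot v w) := by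
  have h1 : dot (dot u v) w = ((u ⊗ₘ v) ⊗ₘ w) ≫ μ[M] ▷ M ≫ μ[M] := by
    rw [dot, dot, ← tensorHom_id, tensorHom_comp_tensorHom_assoc, Category.comp_id]
  have h2 : dot u (dot v w) = (u ⊗ₘ (v ⊗ₘ w)) ≫ M ◁ μ[M] ≫ μ[M] := by
    rw [dot, dot, ← id_tensorHom, tensorHom_comp_tensorHom_assoc, Category.comp_id]
  rw [h1, h2, MonObj.mul_assoc, associator_naturality_assoc]

lemma dot_comp (u : X ⟶ M) (v : Y ⟶ M) (h : M ⟶ N) [IsMonHom h] :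
    dot u v ≫ h = dot (u ≫ h) (v ≫ h) := by
  simp [dot]

lemma one_dot (v : Y ⟶ M) : dot η[M] v = (λ_ Y).hom ≫ v := by
  rw [dot, MonoidalCategory.tensorHom_def', Category.assoc, MonObj.one_mul, leftUnitor_naturality]

lemma dot_one (u : X ⟶ M) : dot u η[M] = (ρ_ X).hom ≫ u := by
  rw [dot, MonoidalCategory.tensorHom_def, Category.assoc, MonObj.mul_one, rightUnitor_naturality]

/-- The product of a morphism into a monoid with a global element on the right. -/
def rdot (u : X ⟶ M) (t : 𝟙_ V ⟶ M) : X ⟶ M := (ρ_ X).inv ≫ dot u t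

/-- The product of a morphism into a monoid with a global element on the left. -/
def ldot (t : 𝟙_ V ⟶ M) (v : Y ⟶ M) : Y ⟶ M := (λ_ Y).inv ≫ dot t v

lemma comp_rdot (f : X' ⟶ X) (u : X ⟶ M) (t : 𝟙_ V ⟶ M) : f ≫ rdot u t = rdot (f ≫ u) t := by
  rw [rdot, rdot, ← comp_dot, rightUnitor_inv_naturality_assoc]

lemma rdot_comp (u : X ⟶ M) (t : 𝟙_ V ⟶ M) (h : M ⟶ N) [IsMonHom h] :
    rdot u t ≫ h = rdot (u ≫ h) (t ≫ h) := by
  rw [rdot, rdot, Category.assoc, dot_comp]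

lemma dot_rdot (u : X ⟶ M) (v : Y ⟶ M) (t : 𝟙_ V ⟶ M) :
    dot u (rdot v t) = rdot (dot u v) t := by
  rw [rdot, rdot, dot_assoc, ← whiskerLeft_dot]
  simp

lemma rdot_dot (u : X ⟶ M) (t : 𝟙_ V ⟶ M) (v : Y ⟶ M) :
    dot (rdot u t) v = dot u (ldot t v) := by
  rw [rdot, ldot, ← comp_dot, dot_assoc, ← whiskerLeft_dot]
  simp

lemma rdot_rdot (u : X ⟶ M) (t t' : 𝟙_ V ⟶ M) :
    rdot (rdot u t) t' = rdot u (rdot t t') := by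
  rw [rdot, rdot_dot, rdot, ldot, rdot, unitors_inv_equal]

lemma rdot_one (u : X ⟶ M) : rdot u η[M] = u := by
  rw [rdot, dot_one, Iso.inv_hom_id_assoc]

end Monoid

section Inclusions

/-- The inclusion of the first factor of a tensor product of monoids. -/
def inl (M N : V) [MonObj N] : M ⟶ M ⊗ N := (ρ_ M).inv ≫ M ◁ η[N]

/-- The inclusion of the second factor of a tensor product of monoids. -/
def inr (M N : V) [MonObj M] : N ⟶ M ⊗ N := (λ_ N).inv ≫ η[M] ▷ N

lemma inr_comp_inl_comp_associator (M N P : V) [MonObj M] [MonObj P] :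
    inr M N ≫ inl (M ⊗ N) P ≫ (α_ M N P).hom = inl N P ≫ inr M (N ⊗ P) := by
  rw [inl, inr, inl, inr]
  calc
    _ = (λ_ _).inv ≫ (ρ_ _).inv ≫ (η[M] ▷ N) ▷ (𝟙_ V) ≫ (M ⊗ N) ◁ η[P] ≫ (α_ M N P).hom := by
      monoidal
    _ = _ := by
      rw [← whisker_exchange_assoc]
      monoidal

lemma inr_comp_whiskerLeft (M : V) [MonObj M] {N P : V} (f : N ⟶ P) :
    inr M N ≫ M ◁ f = f ≫ inr M P := by
  rw [inr, inr, Category.assoc, ← whisker_exchange, leftUnitor_inv_naturality_assoc]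

lemma inr_whiskerRight_comp_associator (M N X : V) [MonObj M] :
    inr M N ▷ X ≫ (α_ M N X).hom = inr M (N ⊗ X) := by
  rw [inr, inr]
  monoidal

end Inclusions

section TensorProduct

variable [BraidedCategory V]

variable {M N X Y Z : V} [MonObj M] [MonObj N]

/-- The right side is the Kleisli extension of `m` for the monad `M ⊗ -`, so Kleisli composites
become products. The only braiding involved is with the unit object, hence trivial. -/
lemma inl_dot (m : Z ⟶ M ⊗ N) :
    dot (inl M N) m = M ◁ m ≫ (α_ M M N).inv ≫ μ[M] ▷ N := by
  have h : dot (inl M N) (𝟙 (M ⊗ N)) = (α_ M M N).inv ≫ μ[M] ▷ N := by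
    have h1 := tensorμ_natural_left (𝟙 M) η[N] M N
    rw [id_tensorHom, id_whiskerRight] at h1
    rw [dot, tensorHom_id, MonObj.tensorObj.mul_def, inl, comp_whiskerRight, Category.assoc,
      reassoc_of% h1, tensorHom_comp_tensorHom, Category.id_comp, MonObj.one_mul, tensorμ,
      braiding_tensorUnit_left]
    monoidal
  rw [← h, whiskerLeft_dot, Category.comp_id]

lemma dot_inr (m : Z ⟶ M ⊗ N) :
    dot m (inr M N) = m ▷ N ≫ (α_ M N N).hom ≫ M ◁ μ[N] := by
  have h : dot (𝟙 (M ⊗ N)) (inr M N) = (α_ M N N).hom ≫ M ◁ μ[N] := by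
    have h1 := tensorμ_natural_right M N η[M] (𝟙 N)
    rw [tensorHom_id, whiskerLeft_id] at h1
    rw [dot, id_tensorHom, MonObj.tensorObj.mul_def, inr, whiskerLeft_comp, Category.assoc,
      reassoc_of% h1, tensorHom_comp_tensorHom, Category.id_comp, MonObj.mul_one, tensorμ,
      braiding_tensorUnit_right]
    monoidal
  rw [← h, comp_dot, Category.comp_id]

/-- Lets a leading `inl • (inr • v)` be regrouped as `𝟙 • v`, which absorbs any morphism placed in
front of it. -/
lemma dot_inl_inr : dot (inl M N) (inr M N) = 𝟙 (M ⊗ N) := by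
  have h : dot (inl M N) (inr M N) =
      (𝟙 _ ⊗≫ (M ◁ η[M] ≫ μ[M]) ▷ N : M ⊗ N ⟶ M ⊗ N) := by
    rw [inl_dot, inr]
    monoidal
  rw [h, MonObj.mul_one]
  monoidal

lemma dot_inl_comp_inr (f : X ⟶ N) : dot (inl M N) (f ≫ inr M N) = M ◁ f := by
  rw [← whiskerLeft_dot, dot_inl_inr, Category.comp_id]

instance : IsMonHom (inr M N) where
  one_hom := by
    rw [inr, MonObj.tensorObj.one_def, MonoidalCategory.tensorHom_def',
      leftUnitor_inv_naturality_assoc]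
  mul_hom := by
    change _ = dot (inr M N) (inr M N)
    rw [dot_inr, inr]
    calc
      _ = (λ_ _).inv ≫ (𝟙_ V ◁ μ[N] ≫ η[M] ▷ N) := by simp
      _ = _ := by
        rw [whisker_exchange]
        monoidal

lemma dot_whiskerRight (u : X ⟶ M) (v : Y ⟶ M) :
    dot u v ▷ N = (α_ X Y N).hom ≫ dot (u ≫ inl M N) (v ▷ N) := by
  rw [← comp_dot, inl_dot, dot, MonoidalCategory.tensorHom_def]
  simp

/-- Unlike in `dot_whiskerRight`, the factor `N` can stay with `u`: it only has to cross the unit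
object, the domain of `t`. -/
lemma rdot_whiskerRight (u : X ⟶ M) (t : 𝟙_ V ⟶ M) :
    rdot u t ▷ N = rdot (u ▷ N) (t ≫ inl M N) := by
  have h1 := tensorμ_natural_right M N t η[N]
  have h2 : t ≫ inl M N = (λ_ (𝟙_ V)).inv ≫ (t ⊗ₘ η[N]) := by
    rw [inl, MonoidalCategory.tensorHom_def, rightUnitor_inv_naturality_assoc, unitors_inv_equal]
  symm
  rw [h2, rdot, dot, MonObj.tensorObj.mul_def, MonoidalCategory.tensorHom_def, whiskerLeft_comp,
    Category.assoc, Category.assoc, reassoc_of% h1, tensorHom_comp_tensorHom, MonObj.mul_one,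
    tensorμ, braiding_tensorUnit_right, rdot, dot, MonoidalCategory.tensorHom_def u t]
  monoidal

lemma inr_comp_whiskerRight_comp_associator (P : V) (f : M ⟶ M ⊗ N) [IsMonHom f] :
    inr M P ≫ f ▷ P ≫ (α_ M N P).hom = inr N P ≫ inr M (N ⊗ P) := by
  rw [inr, Category.assoc, ← comp_whiskerRight_assoc, IsMonHom.one_hom,
    MonObj.tensorObj.one_def, MonoidalCategory.tensorHom_def']
  rw [inr, inr]
  monoidal

instance (B : V) [BimonObj B] : IsMonHom Δ[B] where
  one_hom := BimonObj.one_comul B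
  mul_hom := BimonObj.mul_comul B

instance (B : V) [BimonObj B] : IsMonHom ε[B] where
  one_hom := BimonObj.one_counit B
  mul_hom := BimonObj.mul_counit B

end TensorProduct

end Dot

/-! ### The opwreath axioms for a twisted coaction -/

namespace TwistedCoaction

open scoped MonObj ComonObj

variable {V : Type u} [Category.{v} V] [MonoidalCategory V] [BraidedCategory V] {A B : V}
  [MonObj A] [BimonObj B] (c : TwistedCoaction A B)

instance : IsMonHom c.coact := c.isMonHom_coact

lemma zeta_eq : c.zeta = dot (inr A B) c.coact := rfl

lemma delta_eq : c.delta = rdot (Δ[B] ≫ inr A (B ⊗ B)) c.τ := by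
  rw [delta, rdot, inr, MonoidalCategory.tensorHom_def', leftUnitor_inv_naturality_assoc]

/-- Multiplicativity of `γ`: the right side is `(inr • γ) • γ`, which regroups to `inr • (γ • γ)`.
-/
lemma mul_zeta : B ◁ μ[A] ≫ c.zeta =
    (α_ B A A).inv ≫ c.zeta ▷ A ≫ (α_ A B A).hom ≫ A ◁ c.zeta ≫ (α_ A A B).inv ≫ μ[A] ▷ B := by
  have h : μ[A] ≫ c.coact = dot c.coact c.coact := IsMonHom.mul_hom c.coact
  rw [← inl_dot]
  conv_rhs => rw [zeta_eq c]
  rw [← dot_assoc, dot_inl_inr, comp_dot, Category.comp_id, zeta_eq, whiskerLeft_dot, h, dot_assoc,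
    Iso.inv_hom_id_assoc]

lemma one_zeta : B ◁ η[A] ≫ c.zeta = (ρ_ B).hom ≫ inr A B := by
  rw [zeta_eq, whiskerLeft_dot, IsMonHom.one_hom, dot_one]

lemma zeta_comp_counit : c.zeta ≫ A ◁ ε[B] ≫ (ρ_ A).hom = ε[B] ▷ A ≫ (λ_ A).hom := by
  have h : inr A B ≫ A ◁ ε[B] ≫ (ρ_ A).hom = ε[B] ≫ η[A] := by
    rw [reassoc_of% inr_comp_whiskerLeft, inr]
    simp [unitors_inv_equal]
  rw [zeta_eq, dot_comp, h, c.counitality, ← comp_dot, one_dot, Category.comp_id]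

/-- The two copies of `B` enter through `inl B B` and `inr B B`. Their product is `𝟙`, and `inr A (B
⊗ B)` is a monoid morphism, so they combine into a single factor. -/
lemma zeta_zeta : B ◁ c.zeta ≫ (α_ B A B).inv ≫ c.zeta ▷ B ≫ (α_ A B B).hom =
    (α_ B B A).inv ≫ dot (inr A (B ⊗ B)) (c.coact ≫ c.coact ▷ B ≫ (α_ A B B).hom) := by
  have h : dot (inl B B ≫ inr A (B ⊗ B)) (inr B B ≫ inr A (B ⊗ B)) = inr A (B ⊗ B) := by
    rw [← dot_comp, dot_inl_inr, Category.id_comp]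
  conv_lhs =>
    rw [zeta_eq, dot_whiskerRight, Category.assoc, Iso.inv_hom_id_assoc, dot_comp, Category.assoc,
      inr_comp_inl_comp_associator, whiskerLeft_dot, dot_comp,
      inr_comp_whiskerRight_comp_associator]
  rw [← h, dot_assoc, Iso.inv_hom_id_assoc, h]

lemma whiskerLeft_delta_mul :
    A ◁ c.delta ≫ (α_ A A (B ⊗ B)).inv ≫ μ[A] ▷ (B ⊗ B) = rdot (A ◁ Δ[B]) c.τ := by
  rw [← inl_dot, delta_eq, dot_rdot, dot_inl_comp_inr]

/-- Writing `Δ` for `Δ ≫ inr`, the left side is `Δ • τ • (γ ≫ γ ▷ B)` and the right side is `Δ • (γ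
≫ A ◁ Δ[B]) • τ`; they agree by twisted coassociativity. -/
lemma delta_zeta :
    c.delta ▷ A ≫ (α_ A (B ⊗ B) A).hom ≫ A ◁ ((α_ B B A).hom ≫ B ◁ c.zeta ≫ (α_ B A B).inv ≫
        c.zeta ▷ B ≫ (α_ A B B).hom) ≫ (α_ A A (B ⊗ B)).inv ≫ μ[A] ▷ (B ⊗ B) =
      c.zeta ≫ A ◁ c.delta ≫ (α_ A A (B ⊗ B)).inv ≫ μ[A] ▷ (B ⊗ B) := by
  have h := c.coassociativity
  change ldot _ _ = rdot _ _ at h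
  rw [zeta_zeta, ← inl_dot, Iso.hom_inv_id_assoc, ← dot_assoc, dot_inl_inr, comp_dot,
    Category.comp_id, whiskerLeft_delta_mul, comp_rdot, zeta_eq, dot_comp, inr_comp_whiskerLeft,
    ← dot_rdot, ← h, delta_eq, rdot_dot]

lemma delta_counit_left : c.delta ≫ A ◁ (ε[B] ▷ B ≫ (λ_ B).hom) = inr A B := by
  have h : c.τ ≫ A ◁ (ε[B] ▷ B ≫ (λ_ B).hom) = η[A ⊗ B] := by
    rw [whiskerLeft_comp, c.normality_left, MonObj.tensorObj.one_def, unitors_inv_equal]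
  rw [delta_eq, rdot_comp, h, rdot_one, Category.assoc, inr_comp_whiskerLeft]
  simp

lemma delta_counit_right : c.delta ≫ A ◁ (B ◁ ε[B] ≫ (ρ_ B).hom) = inr A B := by
  have h : c.τ ≫ A ◁ (B ◁ ε[B] ≫ (ρ_ B).hom) = η[A ⊗ B] := by
    rw [whiskerLeft_comp, c.normality_right, MonObj.tensorObj.one_def, unitors_inv_equal]
  rw [delta_eq, rdot_comp, h, rdot_one, Category.assoc, inr_comp_whiskerLeft]
  simp

/-- Normal form for coassociativity: the iterated comultiplication of `B`, times one side of the
cocycle condition. `delta_delta_right` produces the other side. -/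
lemma delta_delta_left :
    c.delta ≫ A ◁ (c.delta ▷ B ≫ (α_ A (B ⊗ B) B).hom ≫ A ◁ (α_ B B B).hom) ≫
        (α_ A A (B ⊗ (B ⊗ B))).inv ≫ μ[A] ▷ (B ⊗ (B ⊗ B)) =
      rdot ((Δ[B] ≫ Δ[B] ▷ B ≫ (α_ B B B).hom) ≫ inr A (B ⊗ (B ⊗ B)))
        (rdot (c.τ ≫ A ◁ (Δ[B] ▷ B ≫ (α_ B B B).hom))
          (c.τ ≫ inl (A ⊗ (B ⊗ B)) B ≫ (α_ A (B ⊗ B) B).hom ≫ A ◁ (α_ B B B).hom)) := by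
  have h : (Δ[B] ≫ inr A (B ⊗ B)) ▷ B ≫ (α_ A (B ⊗ B) B).hom ≫ A ◁ (α_ B B B).hom =
      (Δ[B] ▷ B ≫ (α_ B B B).hom) ≫ inr A (B ⊗ (B ⊗ B)) := by
    rw [comp_whiskerRight, Category.assoc, reassoc_of% inr_whiskerRight_comp_associator,
      inr_comp_whiskerLeft, Category.assoc]
  rw [← inl_dot]
  conv_lhs =>
    enter [2, 2]
    rw [delta_eq, rdot_whiskerRight, rdot_comp, h]
  rw [dot_rdot, dot_inl_comp_inr, comp_rdot, delta_eq, rdot_comp, rdot_rdot, Category.assoc,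
    inr_comp_whiskerLeft]
  simp only [Category.assoc]

lemma delta_delta_right :
    c.delta ≫ A ◁ (B ◁ c.delta ≫ (α_ B A (B ⊗ B)).inv ≫ c.zeta ▷ (B ⊗ B) ≫
        (α_ A B (B ⊗ B)).hom) ≫
        (α_ A A (B ⊗ (B ⊗ B))).inv ≫ μ[A] ▷ (B ⊗ (B ⊗ B)) =
      rdot ((Δ[B] ≫ B ◁ Δ[B]) ≫ inr A (B ⊗ (B ⊗ B)))
        (rdot (c.τ ≫ A ◁ (B ◁ Δ[B])) (c.τ ≫ c.coact ▷ (B ⊗ B) ≫ (α_ A B (B ⊗ B)).hom)) := by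
  have h' : dot (inl B (B ⊗ B) ≫ inr A (B ⊗ (B ⊗ B)))
      ((Δ[B] ≫ inr B (B ⊗ B)) ≫ inr A (B ⊗ (B ⊗ B))) = B ◁ Δ[B] ≫ inr A (B ⊗ (B ⊗ B)) := by
    rw [← dot_comp (h := inr A (B ⊗ (B ⊗ B))), dot_inl_comp_inr]
  have h : B ◁ c.delta ≫ (α_ B A (B ⊗ B)).inv ≫ c.zeta ▷ (B ⊗ B) ≫ (α_ A B (B ⊗ B)).hom =
      rdot (B ◁ Δ[B] ≫ inr A (B ⊗ (B ⊗ B)))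
        (c.τ ≫ c.coact ▷ (B ⊗ B) ≫ (α_ A B (B ⊗ B)).hom) := by
    rw [zeta_eq, dot_whiskerRight, Category.assoc, Iso.inv_hom_id_assoc, dot_comp, Category.assoc,
      inr_comp_inl_comp_associator, whiskerLeft_dot, delta_eq, rdot_comp, Category.assoc,
      inr_comp_whiskerRight_comp_associator, dot_rdot, ← Category.assoc Δ[B], h']
  rw [h, ← inl_dot, dot_rdot, dot_inl_comp_inr, comp_rdot, delta_eq, rdot_comp, rdot_rdot,
    Category.assoc, inr_comp_whiskerLeft, Category.assoc]

lemma delta_coassoc :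
    c.delta ≫ A ◁ (c.delta ▷ B ≫ (α_ A (B ⊗ B) B).hom ≫ A ◁ (α_ B B B).hom) ≫
        (α_ A A (B ⊗ (B ⊗ B))).inv ≫ μ[A] ▷ (B ⊗ (B ⊗ B)) =
      c.delta ≫ A ◁ (B ◁ c.delta ≫ (α_ B A (B ⊗ B)).inv ≫ c.zeta ▷ (B ⊗ B) ≫
        (α_ A B (B ⊗ B)).hom) ≫
        (α_ A A (B ⊗ (B ⊗ B))).inv ≫ μ[A] ▷ (B ⊗ (B ⊗ B)) := by
  have h := c.cocyclicity
  have h1 : (ρ_ (𝟙_ V)).inv ≫ (c.τ ⊗ₘ η[B]) ≫ (α_ A (B ⊗ B) B).hom ≫ A ◁ (α_ B B B).hom =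
      c.τ ≫ inl (A ⊗ (B ⊗ B)) B ≫ (α_ A (B ⊗ B) B).hom ≫ A ◁ (α_ B B B).hom := by
    rw [inl, MonoidalCategory.tensorHom_def]
    simp
  rw [h1, ← whiskerLeft_comp] at h
  rw [delta_delta_left, delta_delta_right, rdot, rdot, h, ComonObj.comul_assoc]
  rfl

/-- Each axiom at `X` is an equation free of `X`, whiskered by `X`; the `calc` steps isolate that
equation up to coherence. -/
theorem isMixedOpwreath : c.opwreathData.IsMixedOpwreath where
  ζ_mul X := by
    change B ◁ ((α_ A A X).inv ≫ μ ▷ X) ≫ (α_ B A X).inv ≫ c.zeta ▷ X ≫ (α_ A B X).hom =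
      ((α_ B A (A ⊗ X)).inv ≫ c.zeta ▷ (A ⊗ X) ≫ (α_ A B (A ⊗ X)).hom) ≫
        A ◁ ((α_ B A X).inv ≫ c.zeta ▷ X ≫ (α_ A B X).hom) ≫ (α_ A A (B ⊗ X)).inv ≫ μ ▷ (B ⊗ X)
    calc
      _ = 𝟙 _ ⊗≫ (B ◁ μ[A] ≫ c.zeta) ▷ X ⊗≫ 𝟙 _ := by monoidal
      _ = _ := by rw [mul_zeta]; monoidal
  ζ_unit X := by
    change B ◁ ((λ_ X).inv ≫ η ▷ X) ≫ (α_ B A X).inv ≫ c.zeta ▷ X ≫ (α_ A B X).hom =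
      (λ_ (B ⊗ X)).inv ≫ η ▷ (B ⊗ X)
    calc
      _ = 𝟙 _ ⊗≫ (B ◁ η[A] ≫ c.zeta) ▷ X ⊗≫ 𝟙 _ := by monoidal
      _ = _ := by rw [one_zeta, inr]; monoidal
  ε_ζ X := by
    change c.eps ▷ (A ⊗ X) ≫ (α_ A A X).inv ≫ μ ▷ X =
      ((α_ B A X).inv ≫ c.zeta ▷ X ≫ (α_ A B X).hom) ≫ A ◁ (c.eps ▷ X) ≫ (α_ A A X).inv ≫ μ ▷ X
    rw [eps]
    calc
      _ = 𝟙 _ ⊗≫ (ε[B] ▷ A ≫ η[A] ▷ A ≫ μ[A]) ▷ X ⊗≫ 𝟙 _ := by monoidal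
      _ = 𝟙 _ ⊗≫ (c.zeta ≫ A ◁ ε[B] ≫ A ◁ η[A] ≫ μ[A]) ▷ X ⊗≫ 𝟙 _ := by
        rw [MonObj.one_mul, MonObj.mul_one, zeta_comp_counit]
      _ = _ := by monoidal
  δ_ζ X := by
    change (c.delta ▷ (A ⊗ X) ≫ (α_ A (B ⊗ B) (A ⊗ X)).hom ≫ A ◁ (α_ B B (A ⊗ X)).hom) ≫
        A ◁ B ◁ ((α_ B A X).inv ≫ c.zeta ▷ X ≫ (α_ A B X).hom) ≫
        A ◁ ((α_ B A (B ⊗ X)).inv ≫ c.zeta ▷ (B ⊗ X) ≫ (α_ A B (B ⊗ X)).hom) ≫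
        (α_ A A (B ⊗ (B ⊗ X))).inv ≫ μ ▷ (B ⊗ (B ⊗ X)) =
      ((α_ B A X).inv ≫ c.zeta ▷ X ≫ (α_ A B X).hom) ≫
        A ◁ (c.delta ▷ X ≫ (α_ A (B ⊗ B) X).hom ≫ A ◁ (α_ B B X).hom) ≫
        (α_ A A (B ⊗ (B ⊗ X))).inv ≫ μ ▷ (B ⊗ (B ⊗ X))
    calc
      _ = 𝟙 _ ⊗≫ (c.delta ▷ A ≫ (α_ A (B ⊗ B) A).hom ≫ A ◁ ((α_ B B A).hom ≫ B ◁ c.zeta ≫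
          (α_ B A B).inv ≫ c.zeta ▷ B ≫ (α_ A B B).hom) ≫
          (α_ A A (B ⊗ B)).inv ≫ μ[A] ▷ (B ⊗ B)) ▷ X ⊗≫ 𝟙 _ := by monoidal
      _ = _ := by rw [delta_zeta]; monoidal
  coassoc X := by
    change (c.delta ▷ X ≫ (α_ A (B ⊗ B) X).hom ≫ A ◁ (α_ B B X).hom) ≫
        A ◁ (c.delta ▷ (B ⊗ X) ≫ (α_ A (B ⊗ B) (B ⊗ X)).hom ≫ A ◁ (α_ B B (B ⊗ X)).hom) ≫
        (α_ A A (B ⊗ (B ⊗ (B ⊗ X)))).inv ≫ μ ▷ (B ⊗ (B ⊗ (B ⊗ X))) =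
      (c.delta ▷ X ≫ (α_ A (B ⊗ B) X).hom ≫ A ◁ (α_ B B X).hom) ≫
        A ◁ B ◁ (c.delta ▷ X ≫ (α_ A (B ⊗ B) X).hom ≫ A ◁ (α_ B B X).hom) ≫
        A ◁ ((α_ B A (B ⊗ (B ⊗ X))).inv ≫ c.zeta ▷ (B ⊗ (B ⊗ X)) ≫ (α_ A B (B ⊗ (B ⊗ X))).hom) ≫
        (α_ A A (B ⊗ (B ⊗ (B ⊗ X)))).inv ≫ μ ▷ (B ⊗ (B ⊗ (B ⊗ X)))
    calc
      _ = 𝟙 _ ⊗≫ (c.delta ≫ A ◁ (c.delta ▷ B ≫ (α_ A (B ⊗ B) B).hom ≫ A ◁ (α_ B B B).hom) ≫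
        (α_ A A (B ⊗ (B ⊗ B))).inv ≫ μ[A] ▷ (B ⊗ (B ⊗ B))) ▷ X ⊗≫ 𝟙 _ := by monoidal
      _ = _ := by rw [delta_coassoc]; monoidal
  counit_left X := by
    change (c.delta ▷ X ≫ (α_ A (B ⊗ B) X).hom ≫ A ◁ (α_ B B X).hom) ≫ A ◁ c.eps ▷ (B ⊗ X) ≫
        (α_ A A (B ⊗ X)).inv ≫ μ ▷ (B ⊗ X) = (λ_ (B ⊗ X)).inv ≫ η ▷ (B ⊗ X)
    rw [eps]
    calc
      _ = 𝟙 _ ⊗≫ (c.delta ⊗≫ A ◁ ε[B] ▷ B ⊗≫ (A ◁ η[A] ≫ μ[A]) ▷ B) ▷ X ⊗≫ 𝟙 _ := by monoidal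
      _ = 𝟙 _ ⊗≫ (c.delta ≫ A ◁ (ε[B] ▷ B ≫ (λ_ B).hom)) ▷ X ⊗≫ 𝟙 _ := by
        rw [MonObj.mul_one]; monoidal
      _ = _ := by rw [delta_counit_left, inr]; monoidal
  counit_right X := by
    change (c.delta ▷ X ≫ (α_ A (B ⊗ B) X).hom ≫ A ◁ (α_ B B X).hom) ≫ A ◁ B ◁ c.eps ▷ X ≫
        A ◁ ((α_ B A X).inv ≫ c.zeta ▷ X ≫ (α_ A B X).hom) ≫
        (α_ A A (B ⊗ X)).inv ≫ μ ▷ (B ⊗ X) = (λ_ (B ⊗ X)).inv ≫ η ▷ (B ⊗ X)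
    rw [eps]
    calc
      _ = 𝟙 _ ⊗≫ (c.delta ≫ A ◁ B ◁ ε[B] ≫ A ◁ (B ◁ η[A] ≫ c.zeta) ⊗≫ μ[A] ▷ B) ▷ X ⊗≫ 𝟙 _ := by
        monoidal
      _ = 𝟙 _ ⊗≫ (c.delta ≫ A ◁ B ◁ ε[B] ⊗≫ (A ◁ η[A] ≫ μ[A]) ▷ B) ▷ X ⊗≫ 𝟙 _ := by
        rw [one_zeta, inr]; monoidal
      _ = 𝟙 _ ⊗≫ (c.delta ≫ A ◁ (B ◁ ε[B] ≫ (ρ_ B).hom)) ▷ X ⊗≫ 𝟙 _ := by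
        rw [MonObj.mul_one]; monoidal
      _ = _ := by rw [delta_counit_right, inr]; monoidal

end TwistedCoaction

/-! ### The opmonoidality equations for `ψ` -/

section MonoidalCoaction

open scoped MonObj ComonObj

section Braiding

variable {V : Type u} [Category.{v} V] [MonoidalCategory V] [BraidedCategory V]

/-- By naturality `X` crosses `A ⊗ Q` after `g` instead of `P` before it. The inverse crossing with
`A` cancels the final braiding, leaving only the crossing with `Q`. -/
lemma braiding_inv_comp_whiskerLeft_braiding (X : V) {P A Q : V} (g : P ⟶ A ⊗ Q) :
    (β_ X P).inv ≫ X ◁ g ≫ (α_ X A Q).inv ≫ (β_ X A).hom ▷ Q =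
      g ▷ X ≫ (α_ A Q X).hom ≫ A ◁ (β_ X Q).inv ≫ (α_ A X Q).inv := by
  rw [← BraidedCategory.braiding_inv_naturality_left_assoc,
    BraidedCategory.braiding_tensor_right_inv]
  simp

end Braiding

section TensorMonad

variable {V : Type u} [Category.{v} V] [MonoidalCategory V]

lemma whiskerLeft_one_mul (A X : V) [MonObj A] :
    A ◁ ((λ_ X).inv ≫ η[A] ▷ X) ≫ (α_ A A X).inv ≫ μ[A] ▷ X = 𝟙 (A ⊗ X) :=
  (tensorMonad A).right_unit X

variable [BraidedCategory V]

lemma one_tensorφ (A X Y : V) [MonObj A] :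
    ((λ_ X).inv ≫ η[A] ▷ X) ▷ (A ⊗ Y) ≫ tensorφ A X Y =
      (α_ X A Y).inv ≫ (β_ X A).hom ▷ Y ≫ (α_ A X Y).hom := by
  have h := tensorμ_natural_left η[A] (𝟙 X) A Y
  rw [tensorHom_id] at h
  rw [tensorφ, comp_whiskerRight, Category.assoc, reassoc_of% h, id_whiskerRight, tensorHom_id,
    ← comp_whiskerRight, MonObj.one_mul, tensorμ]
  monoidal

lemma tensorφ_one (A X Y : V) [MonObj A] :
    (A ⊗ X) ◁ ((λ_ Y).inv ≫ η[A] ▷ Y) ≫ tensorφ A X Y = (α_ A X Y).hom := by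
  have h := tensorμ_natural_right A X η[A] (𝟙 Y)
  rw [tensorHom_id] at h
  rw [tensorφ, whiskerLeft_comp, Category.assoc, reassoc_of% h, whiskerLeft_id, tensorHom_id,
    ← comp_whiskerRight, MonObj.mul_one, tensorμ, braiding_tensorUnit_right]
  monoidal

/-- Tensoring in the Kleisli category extends the tensor of `V`. It applies to the counit, which
comes from `V` by `eps_whiskerRight`. -/
lemma one_tensorφ_one {A X Y X' Y' : V} [MonObj A] (f : X ⟶ Y) (f' : X' ⟶ Y') :
    A ◁ ((f ≫ (λ_ Y).inv ≫ η[A] ▷ Y ⊗ₘ f' ≫ (λ_ Y').inv ≫ η[A] ▷ Y') ≫ tensorφ A Y Y') ≫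
      (α_ A A (Y ⊗ Y')).inv ≫ μ[A] ▷ (Y ⊗ Y') = A ◁ (f ⊗ₘ f') := by
  rw [← tensorHom_comp_tensorHom, Category.assoc, tensorφ_unit, whiskerLeft_comp, Category.assoc,
    whiskerLeft_one_mul, Category.comp_id]

end TensorMonad

namespace MonoidalTwistedCoaction

variable {V : Type u} [Category.{v} V] [MonoidalCategory V] [BraidedCategory V] {A B : V}
  [MonObj A] [BimonObj B] (c : MonoidalTwistedCoaction A B)

lemma eps_whiskerRight (X : V) :
    c.eps ▷ X = (ε[B] ▷ X ≫ (λ_ X).hom) ≫ (λ_ X).inv ≫ η[A] ▷ X := by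
  simp [TwistedCoaction.eps]

lemma psi_comp_counit_right (X Y : V) :
    c.psi X Y ≫ A ◁ ((B ⊗ X) ◁ (ε[B] ▷ Y ≫ (λ_ Y).hom)) =
      (λ_ _).inv ≫ η[A] ▷ (B ⊗ (X ⊗ Y)) ≫ A ◁ (α_ B X Y).inv := by
  calc
    _ = c.𝔡 ▷ (X ⊗ Y) ⊗≫ (A ⊗ B) ◁ ((β_ X B).inv ≫ X ◁ ε[B]) ▷ Y ⊗≫ 𝟙 _ := by
      rw [psi]; monoidal
    _ = (c.𝔡 ≫ A ◁ (B ◁ ε[B]) ≫ A ◁ (ρ_ B).hom) ▷ (X ⊗ Y) ⊗≫ 𝟙 _ := by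
      rw [← BraidedCategory.braiding_inv_naturality_left, braiding_inv_tensorUnit_right]
      monoidal
    _ = _ := by rw [c.𝔡_counit_right]; monoidal

/-- Only the unit object stands in the first place: for a general object, its inverse braiding with
the surviving copy of `B` would remain. -/
lemma psi_comp_counit_left (X : V) :
    c.psi (𝟙_ V) X ≫ A ◁ ((ε[B] ▷ 𝟙_ V ≫ (λ_ _).hom) ▷ (B ⊗ X)) =
      (λ_ _).inv ≫ η[A] ▷ (B ⊗ (𝟙_ V ⊗ X)) ⊗≫ 𝟙 _ := by
  calc
    _ = (c.𝔡 ≫ A ◁ (ε[B] ▷ B) ≫ A ◁ (λ_ B).hom) ▷ (𝟙_ V ⊗ X) ⊗≫ 𝟙 _ := by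
      rw [psi, braiding_inv_tensorUnit_left]; monoidal
    _ = _ := by rw [c.𝔡_counit_left]; monoidal

theorem psi_counit_left (X : V) :
    B ◁ (λ_ X).inv ≫ c.psi (𝟙_ V) X ≫
      A ◁ ((c.eps ▷ 𝟙_ V ⊗ₘ ((λ_ (B ⊗ X)).inv ≫ η ▷ (B ⊗ X))) ≫ tensorφ A (𝟙_ V) (B ⊗ X)) ≫
      (α_ A A (𝟙_ V ⊗ (B ⊗ X))).inv ≫ μ ▷ (𝟙_ V ⊗ (B ⊗ X)) =
    (λ_ (B ⊗ X)).inv ≫ (λ_ (𝟙_ V ⊗ (B ⊗ X))).inv ≫ η ▷ (𝟙_ V ⊗ (B ⊗ X)) := by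
  have h := one_tensorφ_one (A := A) (ε[B] ▷ 𝟙_ V ≫ (λ_ _).hom) (𝟙 (B ⊗ X))
  rw [Category.id_comp] at h
  rw [eps_whiskerRight, h, tensorHom_id, psi_comp_counit_left]
  monoidal

theorem psi_counit_right (X : V) :
    B ◁ (ρ_ X).inv ≫ c.psi X (𝟙_ V) ≫
      A ◁ ((((λ_ (B ⊗ X)).inv ≫ η ▷ (B ⊗ X)) ⊗ₘ c.eps ▷ 𝟙_ V) ≫ tensorφ A (B ⊗ X) (𝟙_ V)) ≫
      (α_ A A ((B ⊗ X) ⊗ 𝟙_ V)).inv ≫ μ ▷ ((B ⊗ X) ⊗ 𝟙_ V) =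
    (ρ_ (B ⊗ X)).inv ≫ (λ_ ((B ⊗ X) ⊗ 𝟙_ V)).inv ≫ η ▷ ((B ⊗ X) ⊗ 𝟙_ V) := by
  have h := one_tensorφ_one (A := A) (𝟙 (B ⊗ X)) (ε[B] ▷ 𝟙_ V ≫ (λ_ _).hom)
  rw [Category.id_comp] at h
  rw [eps_whiskerRight, h, id_tensorHom, psi_comp_counit_right]
  monoidal

/-- The counit condition on the second copy of `B` reduces `𝔡` to `η_A ⊗ 1_B`; applying `ε_B` to the
first copy then gives `ε`. -/
theorem psi_eps (X Y : V) :
    c.eps ▷ (X ⊗ Y) =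
      c.psi X Y ≫ A ◁ ((c.eps ▷ X ⊗ₘ c.eps ▷ Y) ≫ tensorφ A X Y) ≫
        (α_ A A (X ⊗ Y)).inv ≫ μ ▷ (X ⊗ Y) := by
  rw [eps_whiskerRight c X, eps_whiskerRight c Y, one_tensorφ_one, MonoidalCategory.tensorHom_def',
    whiskerLeft_comp, reassoc_of% psi_comp_counit_right]
  calc
    _ = 𝟙 _ ⊗≫ (ε[B] ▷ 𝟙_ V ≫ 𝟙_ V ◁ η[A]) ▷ (X ⊗ Y) ⊗≫ 𝟙 _ := by
      rw [TwistedCoaction.eps]; monoidal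
    _ = 𝟙 _ ⊗≫ (η[A] ▷ B ≫ A ◁ ε[B]) ▷ (X ⊗ Y) ⊗≫ 𝟙 _ := by
      rw [← whisker_exchange η[A] ε[B]]
      monoidal
    _ = _ := by monoidal

/-- Interchange collects all occurrences of `𝔡` and `μ` in front, forming one side of `𝔡_𝔡`, and
leaves only braidings behind. `psi_assoc_right` does the same for the other side, and a hexagon
identity matches the braidings. -/
lemma psi_assoc_left (X Y Z : V) :
    c.psi (X ⊗ Y) Z ≫
      A ◁ ((c.psi X Y ⊗ₘ ((λ_ (B ⊗ Z)).inv ≫ η ▷ (B ⊗ Z))) ≫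
        tensorφ A ((B ⊗ X) ⊗ (B ⊗ Y)) (B ⊗ Z)) ≫
      (α_ A A (((B ⊗ X) ⊗ (B ⊗ Y)) ⊗ (B ⊗ Z))).inv ≫ μ ▷ (((B ⊗ X) ⊗ (B ⊗ Y)) ⊗ (B ⊗ Z)) ≫
      A ◁ (α_ (B ⊗ X) (B ⊗ Y) (B ⊗ Z)).hom =
    (c.𝔡 ⊗≫ A ◁ c.𝔡 ▷ B ⊗≫ μ[A] ▷ (B ⊗ (B ⊗ B))) ▷ ((X ⊗ Y) ⊗ Z) ⊗≫
      (A ⊗ B ⊗ B) ◁ (β_ X B).inv ▷ (Y ⊗ Z) ⊗≫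
      (A ⊗ B) ◁ ((β_ X B).inv ▷ (B ⊗ Y) ≫ (X ⊗ B) ◁ (β_ Y B).inv) ▷ Z ⊗≫ 𝟙 _ := by
  rw [MonoidalCategory.tensorHom_def, Category.assoc, tensorφ_one]
  calc
    _ = c.𝔡 ▷ ((X ⊗ Y) ⊗ Z) ⊗≫
        A ◁ (B ◁ (β_ (X ⊗ Y) B).inv ≫ c.𝔡 ▷ ((X ⊗ Y) ⊗ B)) ▷ Z ⊗≫
        (A ⊗ A ⊗ B) ◁ (β_ X B).inv ▷ (Y ⊗ (B ⊗ Z)) ⊗≫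
        μ[A] ▷ (B ⊗ X ⊗ B ⊗ Y ⊗ B ⊗ Z) ⊗≫ 𝟙 _ := by
      rw [psi, psi]; monoidal
    _ = (c.𝔡 ⊗≫ A ◁ c.𝔡 ▷ B) ▷ ((X ⊗ Y) ⊗ Z) ⊗≫
        ((A ⊗ A) ◁ ((B ⊗ B) ◁ (β_ (X ⊗ Y) B).inv ▷ Z ⊗≫ B ◁ (β_ X B).inv ▷ (Y ⊗ (B ⊗ Z))) ≫
          μ[A] ▷ _) ⊗≫ 𝟙 _ := by
      rw [whisker_exchange]; monoidal
    _ = (c.𝔡 ⊗≫ A ◁ c.𝔡 ▷ B ⊗≫ μ[A] ▷ (B ⊗ (B ⊗ B))) ▷ ((X ⊗ Y) ⊗ Z) ⊗≫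
        (A ⊗ B ⊗ B) ◁ (β_ X B).inv ▷ (Y ⊗ Z) ⊗≫
        (A ⊗ B) ◁ ((B ⊗ X) ◁ (β_ Y B).inv ≫ (β_ X B).inv ▷ (Y ⊗ B)) ▷ Z ⊗≫ 𝟙 _ := by
      rw [whisker_exchange, BraidedCategory.braiding_tensor_left_inv]; monoidal
    _ = _ := by
      rw [whisker_exchange]

lemma psi_assoc_right (X Y Z : V) :
    B ◁ (α_ X Y Z).hom ≫ c.psi X (Y ⊗ Z) ≫
      A ◁ ((((λ_ (B ⊗ X)).inv ≫ η ▷ (B ⊗ X)) ⊗ₘ c.psi Y Z) ≫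
        tensorφ A (B ⊗ X) ((B ⊗ Y) ⊗ (B ⊗ Z))) ≫
      (α_ A A ((B ⊗ X) ⊗ ((B ⊗ Y) ⊗ (B ⊗ Z)))).inv ≫ μ ▷ ((B ⊗ X) ⊗ ((B ⊗ Y) ⊗ (B ⊗ Z))) =
    (c.𝔡 ⊗≫ (A ⊗ B) ◁ c.𝔡 ⊗≫ A ◁ (β_ B A).hom ▷ (B ⊗ B) ⊗≫ μ[A] ▷ (B ⊗ (B ⊗ B))) ▷
        ((X ⊗ Y) ⊗ Z) ⊗≫
      (A ⊗ B) ◁ (β_ X (B ⊗ B)).inv ▷ (Y ⊗ Z) ⊗≫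
      (A ⊗ B ⊗ X ⊗ B) ◁ (β_ Y B).inv ▷ Z ⊗≫ 𝟙 _ := by
  rw [MonoidalCategory.tensorHom_def', Category.assoc, one_tensorφ,
    BraidedCategory.braiding_tensor_left_hom]
  calc
    _ = 𝟙 _ ⊗≫ c.𝔡 ▷ (X ⊗ Y ⊗ Z) ⊗≫
        (A ⊗ B) ◁ ((β_ X B).inv ≫ X ◁ c.𝔡) ▷ (Y ⊗ Z) ⊗≫
        (A ⊗ B) ◁ ((X ⊗ A) ◁ (B ◁ (β_ Y B).inv ▷ Z) ≫ (β_ X A).hom ▷ _) ⊗≫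
        A ◁ (β_ B A).hom ▷ (X ⊗ B ⊗ Y ⊗ B ⊗ Z) ⊗≫
        μ[A] ▷ (B ⊗ X ⊗ B ⊗ Y ⊗ B ⊗ Z) ⊗≫ 𝟙 _ := by
      rw [psi, psi]; monoidal
    _ = 𝟙 _ ⊗≫ c.𝔡 ▷ (X ⊗ Y ⊗ Z) ⊗≫
        (A ⊗ B) ◁ ((β_ X B).inv ≫ X ◁ c.𝔡 ≫ (α_ X A (B ⊗ B)).inv ≫ (β_ X A).hom ▷ (B ⊗ B)) ▷
          (Y ⊗ Z) ⊗≫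
        (A ⊗ B ⊗ A ⊗ X) ◁ (B ◁ (β_ Y B).inv ▷ Z) ⊗≫
        A ◁ (β_ B A).hom ▷ (X ⊗ B ⊗ Y ⊗ B ⊗ Z) ⊗≫
        μ[A] ▷ (B ⊗ X ⊗ B ⊗ Y ⊗ B ⊗ Z) ⊗≫ 𝟙 _ := by
      rw [whisker_exchange]; monoidal
    _ = 𝟙 _ ⊗≫ (c.𝔡 ⊗≫ (A ⊗ B) ◁ c.𝔡) ▷ (X ⊗ Y ⊗ Z) ⊗≫
        (((A ⊗ B) ⊗ A) ◁ ((β_ X (B ⊗ B)).inv ▷ (Y ⊗ Z) ⊗≫ (X ⊗ B) ◁ (β_ Y B).inv ▷ Z) ≫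
        (𝟙 _ ⊗≫ A ◁ (β_ B A).hom ⊗≫ μ[A] ▷ B : (A ⊗ B) ⊗ A ⟶ A ⊗ B) ▷
          ((X ⊗ B) ⊗ ((Y ⊗ B) ⊗ Z))) ⊗≫ 𝟙 _ := by
      -- The crossing of `X` with `A` coming from `tensorφ` cancels here.
      rw [braiding_inv_comp_whiskerLeft_braiding]; monoidal
    _ = _ := by
      rw [whisker_exchange]; monoidal

theorem psi_assoc (X Y Z : V) :
    c.psi (X ⊗ Y) Z ≫
      A ◁ ((c.psi X Y ⊗ₘ ((λ_ (B ⊗ Z)).inv ≫ η ▷ (B ⊗ Z))) ≫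
        tensorφ A ((B ⊗ X) ⊗ (B ⊗ Y)) (B ⊗ Z)) ≫
      (α_ A A (((B ⊗ X) ⊗ (B ⊗ Y)) ⊗ (B ⊗ Z))).inv ≫ μ ▷ (((B ⊗ X) ⊗ (B ⊗ Y)) ⊗ (B ⊗ Z)) ≫
      A ◁ (α_ (B ⊗ X) (B ⊗ Y) (B ⊗ Z)).hom =
    B ◁ (α_ X Y Z).hom ≫ c.psi X (Y ⊗ Z) ≫
      A ◁ ((((λ_ (B ⊗ X)).inv ≫ η ▷ (B ⊗ X)) ⊗ₘ c.psi Y Z) ≫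
        tensorφ A (B ⊗ X) ((B ⊗ Y) ⊗ (B ⊗ Z))) ≫
      (α_ A A ((B ⊗ X) ⊗ ((B ⊗ Y) ⊗ (B ⊗ Z)))).inv ≫ μ ▷ ((B ⊗ X) ⊗ ((B ⊗ Y) ⊗ (B ⊗ Z))) := by
  rw [psi_assoc_left, psi_assoc_right, c.𝔡_𝔡, BraidedCategory.braiding_tensor_right_inv]
  monoidal

lemma psi_comp_whiskerLeft_tensor {X X' Y Y' : V} (f : X ⟶ Y) (f' : X' ⟶ Y') :
    c.psi X X' ≫ A ◁ (B ◁ f ⊗ₘ B ◁ f') = B ◁ (f ⊗ₘ f') ≫ c.psi Y Y' := by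
  rw [MonoidalCategory.tensorHom_def, MonoidalCategory.tensorHom_def]
  calc
    _ = c.𝔡 ▷ (X ⊗ X') ⊗≫ (A ⊗ B) ◁ ((β_ X B).inv ≫ f ▷ B) ▷ X' ⊗≫
        (A ⊗ B ⊗ Y ⊗ B) ◁ f' ⊗≫ 𝟙 _ := by
      rw [psi]; monoidal
    _ = c.𝔡 ▷ (X ⊗ X') ⊗≫ (A ⊗ B ⊗ B) ◁ (f ▷ X') ⊗≫
        (A ⊗ B) ◁ ((β_ Y B).inv ▷ X' ≫ (Y ⊗ B) ◁ f') ⊗≫ 𝟙 _ := by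
      rw [← BraidedCategory.braiding_inv_naturality_right]; monoidal
    _ = (c.𝔡 ▷ (X ⊗ X') ≫ (A ⊗ B ⊗ B) ◁ (f ▷ X' ≫ Y ◁ f')) ⊗≫
        (A ⊗ B) ◁ (β_ Y B).inv ▷ Y' ⊗≫ 𝟙 _ := by
      rw [← whisker_exchange]; monoidal
    _ = _ := by
      rw [← whisker_exchange, psi]; monoidal

/-- Naturality for the universal Kleisli morphisms `A ⊗ Y ⟶ Y`, given by identities of `V`. With
naturality in `V`, it implies the general case `psi_natural`. -/
lemma psi_zeta_zeta (Y Y' : V) :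
    c.psi (A ⊗ Y) (A ⊗ Y') ≫ A ◁ ((((α_ B A Y).inv ≫ c.zeta ▷ Y ≫ (α_ A B Y).hom) ⊗ₘ
      ((α_ B A Y').inv ≫ c.zeta ▷ Y' ≫ (α_ A B Y').hom)) ≫
        tensorφ A (B ⊗ Y) (B ⊗ Y')) ≫
      (α_ A A ((B ⊗ Y) ⊗ (B ⊗ Y'))).inv ≫ μ ▷ ((B ⊗ Y) ⊗ (B ⊗ Y')) =
    (B ◁ tensorφ A Y Y' ≫ (α_ B A (Y ⊗ Y')).inv ≫ c.zeta ▷ (Y ⊗ Y') ≫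
      (α_ A B (Y ⊗ Y')).hom) ≫ A ◁ c.psi Y Y' ≫
      (α_ A A ((B ⊗ Y) ⊗ (B ⊗ Y'))).inv ≫ μ ▷ ((B ⊗ Y) ⊗ (B ⊗ Y')) := by
  -- The object `Y` slides across `ζ`: it now crosses `A` before `ζ` is applied and `B` afterwards.
  have hζ : (β_ Y B).inv ▷ A ⊗≫ Y ◁ c.zeta ⊗≫ (β_ Y A).hom ▷ B =
      𝟙 _ ⊗≫ B ◁ (β_ Y A).hom ⊗≫ c.zeta ▷ Y ⊗≫ A ◁ (β_ Y B).inv ⊗≫ 𝟙 _ := by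
    have h := braiding_inv_comp_whiskerLeft_braiding Y c.zeta
    rw [BraidedCategory.braiding_tensor_right_inv] at h
    have h' := congrArg (fun g => (α_ B Y A).hom ≫ B ◁ (β_ Y A).hom ≫ (α_ B A Y).inv ≫ g) h
    simp only [Category.assoc, Iso.inv_hom_id_assoc, whiskerLeft_hom_inv_assoc,
      Iso.hom_inv_id_assoc] at h'
    calc
      _ = (β_ Y B).inv ▷ A ≫ (α_ Y B A).hom ≫ Y ◁ c.zeta ≫
        (α_ Y A B).inv ≫ (β_ Y A).hom ▷ B := by monoidal
      _ = _ := by rw [h']; monoidal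
  rw [MonoidalCategory.tensorHom_def, tensorφ, tensorφ, tensorμ, tensorμ,
    BraidedCategory.braiding_tensor_left_hom]
  calc
    _ = 𝟙 _ ⊗≫ c.𝔡 ▷ (A ⊗ Y ⊗ A ⊗ Y') ⊗≫ (A ⊗ B) ◁ (β_ A B).inv ▷ (Y ⊗ A ⊗ Y') ⊗≫
        A ◁ ((B ⊗ A) ◁ (β_ Y B).inv ≫ c.zeta ▷ (Y ⊗ B)) ▷ (A ⊗ Y') ⊗≫
        (A ⊗ A ⊗ B ⊗ Y) ◁ c.zeta ▷ Y' ⊗≫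
        (A ⊗ A ⊗ B) ◁ (β_ Y A).hom ▷ (B ⊗ Y') ⊗≫
        (A ⊗ A) ◁ (β_ B A).hom ▷ (Y ⊗ B ⊗ Y') ⊗≫
        ((α_ A A A).hom ≫ A ◁ μ[A] ≫ μ[A]) ▷ (B ⊗ Y ⊗ B ⊗ Y') ⊗≫ 𝟙 _ := by
      rw [psi, BraidedCategory.braiding_tensor_left_inv]; monoidal
    _ = 𝟙 _ ⊗≫ (c.𝔡 ▷ A ⊗≫ (A ⊗ B) ◁ (β_ A B).inv ⊗≫ A ◁ c.zeta ▷ B) ▷ (Y ⊗ A ⊗ Y') ⊗≫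
        (A ⊗ A ⊗ B) ◁ ((β_ Y B).inv ▷ A ⊗≫ Y ◁ c.zeta ⊗≫ (β_ Y A).hom ▷ B) ▷ Y' ⊗≫
        (A ⊗ A) ◁ (β_ B A).hom ▷ (Y ⊗ B ⊗ Y') ⊗≫
        (μ[A] ▷ A ≫ μ[A]) ▷ (B ⊗ Y ⊗ B ⊗ Y') ⊗≫ 𝟙 _ := by
      rw [whisker_exchange c.zeta, MonObj.mul_assoc]; monoidal
    -- The type ascriptions bracket the composites on `A` and `B` as single morphisms, so that
    -- interchange moves the braidings of `Y` past them; this assembles the left side of `𝔡_coact`.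
    _ = 𝟙 _ ⊗≫ ((𝟙 _ ⊗≫ c.𝔡 ▷ A ⊗≫ (A ⊗ B) ◁ (β_ A B).inv ⊗≫ A ◁ c.zeta ▷ B :
            B ⊗ A ⟶ A ⊗ (A ⊗ B) ⊗ B) ▷ (Y ⊗ A) ≫
          (A ⊗ (A ⊗ B) ⊗ B) ◁ (β_ Y A).hom) ▷ Y' ⊗≫
        (A ⊗ A ⊗ B) ◁ c.zeta ▷ (Y ⊗ Y') ⊗≫
        ((A ⊗ A ⊗ B ⊗ A) ◁ (β_ Y B).inv ≫
          (𝟙 _ ⊗≫ (A ⊗ A) ◁ (β_ B A).hom ⊗≫ (μ[A] ▷ A ≫ μ[A]) ▷ B :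
            A ⊗ A ⊗ B ⊗ A ⟶ A ⊗ B) ▷ (Y ⊗ B)) ▷ Y' ⊗≫ 𝟙 _ := by
      rw [hζ]; monoidal
    _ = 𝟙 _ ⊗≫ (B ⊗ A) ◁ (β_ Y A).hom ▷ Y' ⊗≫ (c.𝔡 ▷ (A ⊗ A) ⊗≫ (A ⊗ B) ◁ (β_ A B).inv ▷ A ⊗≫
        A ◁ (c.zeta ⊗ₘ c.zeta) ⊗≫
        (A ⊗ A) ◁ (β_ B A).hom ▷ B ⊗≫ (μ[A] ▷ A ≫ μ[A]) ▷ (B ⊗ B)) ▷ (Y ⊗ Y') ⊗≫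
        (A ⊗ B) ◁ (β_ Y B).inv ▷ Y' ⊗≫ 𝟙 _ := by
      rw [← whisker_exchange, whisker_exchange _ (β_ Y B).inv, MonoidalCategory.tensorHom_def]
      monoidal
    _ = 𝟙 _ ⊗≫ (B ⊗ A) ◁ (β_ Y A).hom ▷ Y' ⊗≫ (B ◁ μ[A] ≫ c.zeta ≫ A ◁ c.𝔡) ▷ (Y ⊗ Y') ⊗≫
        (μ[A] ▷ (B ⊗ B ⊗ Y) ≫ A ◁ (B ◁ (β_ Y B).inv)) ▷ Y' ⊗≫ 𝟙 _ := by
      rw [c.𝔡_coact]; monoidal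
    _ = _ := by
      rw [← whisker_exchange, psi]; monoidal

theorem psi_natural {X X' Y Y' : V} (f : X ⟶ A ⊗ Y) (f' : X' ⟶ A ⊗ Y') :
    c.psi X X' ≫ A ◁ (((B ◁ f ≫ (α_ B A Y).inv ≫ c.zeta ▷ Y ≫ (α_ A B Y).hom) ⊗ₘ
      (B ◁ f' ≫ (α_ B A Y').inv ≫ c.zeta ▷ Y' ≫ (α_ A B Y').hom)) ≫
        tensorφ A (B ⊗ Y) (B ⊗ Y')) ≫
      (α_ A A ((B ⊗ Y) ⊗ (B ⊗ Y'))).inv ≫ μ ▷ ((B ⊗ Y) ⊗ (B ⊗ Y')) =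
    (B ◁ ((f ⊗ₘ f') ≫ tensorφ A Y Y') ≫ (α_ B A (Y ⊗ Y')).inv ≫ c.zeta ▷ (Y ⊗ Y') ≫
      (α_ A B (Y ⊗ Y')).hom) ≫ A ◁ c.psi Y Y' ≫
      (α_ A A ((B ⊗ Y) ⊗ (B ⊗ Y'))).inv ≫ μ ▷ ((B ⊗ Y) ⊗ (B ⊗ Y')) := by
  rw [← tensorHom_comp_tensorHom, Category.assoc, whiskerLeft_comp, Category.assoc,
    reassoc_of% psi_comp_whiskerLeft_tensor, psi_zeta_zeta]
  simp only [whiskerLeft_comp, Category.assoc]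

/-- This and `psi_delta_right` bring the two sides of `psi_delta` to those of `𝔡_δ`, followed by the
same inverse braiding of `X` past `B ⊗ B`. -/
lemma psi_delta_left (X Y : V) :
    (c.delta ▷ (X ⊗ Y) ≫ (α_ A (B ⊗ B) (X ⊗ Y)).hom ≫ A ◁ (α_ B B (X ⊗ Y)).hom) ≫
      A ◁ ((B ◁ c.psi X Y ≫ (α_ B A ((B ⊗ X) ⊗ (B ⊗ Y))).inv ≫ c.zeta ▷ ((B ⊗ X) ⊗ (B ⊗ Y)) ≫
          (α_ A B ((B ⊗ X) ⊗ (B ⊗ Y))).hom) ≫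
        A ◁ c.psi (B ⊗ X) (B ⊗ Y) ≫
        (α_ A A ((B ⊗ (B ⊗ X)) ⊗ (B ⊗ (B ⊗ Y)))).inv ≫ μ ▷ ((B ⊗ (B ⊗ X)) ⊗ (B ⊗ (B ⊗ Y)))) ≫
      (α_ A A ((B ⊗ (B ⊗ X)) ⊗ (B ⊗ (B ⊗ Y)))).inv ≫ μ ▷ ((B ⊗ (B ⊗ X)) ⊗ (B ⊗ (B ⊗ Y))) =
    (c.delta ⊗≫ (A ⊗ B) ◁ c.𝔡 ⊗≫ A ◁ c.zeta ▷ (B ⊗ B) ⊗≫ (A ⊗ A) ◁ c.𝔡 ▷ (B ⊗ B) ⊗≫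
        (μ[A] ▷ A ≫ μ[A]) ▷ (B ⊗ (B ⊗ (B ⊗ B))) ⊗≫
        (A ⊗ B) ◁ (β_ B B).inv ▷ B ⊗≫ 𝟙 (A ⊗ (B ⊗ (B ⊗ (B ⊗ B))))) ▷ (X ⊗ Y) ⊗≫
      (A ⊗ B ⊗ B) ◁ (β_ X (B ⊗ B)).inv ▷ Y ⊗≫ 𝟙 _ := by
  calc
    -- The cancelling associators before `A ◁ μ[A]` exhibit the right side of `MonObj.mul_assoc`,
    -- which is rewritten in the next step.
    _ = c.delta ▷ (X ⊗ Y) ⊗≫ (A ⊗ B) ◁ c.𝔡 ▷ (X ⊗ Y) ⊗≫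
        (A ⊗ B ⊗ A ⊗ B) ◁ (β_ X B).inv ▷ Y ⊗≫
        A ◁ c.zeta ▷ (B ⊗ X ⊗ B ⊗ Y) ⊗≫ (A ⊗ A) ◁ c.𝔡 ▷ (B ⊗ X ⊗ B ⊗ Y) ⊗≫
        ((A ⊗ A ⊗ A) ◁ (B ◁ ((β_ B B).inv ▷ X ⊗≫ B ◁ (β_ X B).inv) ▷ (B ⊗ Y)) ≫
        ((α_ A A A).inv ≫ (α_ A A A).hom ≫ A ◁ μ[A] ≫ μ[A]) ▷ _) ⊗≫ 𝟙 _ := by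
      rw [psi, psi, BraidedCategory.braiding_tensor_left_inv]; monoidal
    _ = c.delta ▷ (X ⊗ Y) ⊗≫ (A ⊗ B) ◁ c.𝔡 ▷ (X ⊗ Y) ⊗≫
        ((A ⊗ (B ⊗ A) ⊗ B) ◁ (β_ X B).inv ≫
          (A ◁ c.zeta ▷ B ⊗≫ (A ⊗ A) ◁ c.𝔡 ▷ B ⊗≫ (μ[A] ▷ A ≫ μ[A]) ▷ (B ⊗ B ⊗ B) ⊗≫
            (A ⊗ B) ◁ (β_ B B).inv :
              A ⊗ (B ⊗ A) ⊗ B ⟶ (A ⊗ B) ⊗ B ⊗ B) ▷ (X ⊗ B)) ▷ Y ⊗≫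
        (A ⊗ B ⊗ B) ◁ (β_ X B).inv ▷ (B ⊗ Y) ⊗≫ 𝟙 _ := by
      rw [whisker_exchange ((α_ A A A).inv ≫ _), ← MonObj.mul_assoc]; monoidal
    _ = _ := by
      rw [whisker_exchange _ (β_ X B).inv, BraidedCategory.braiding_tensor_right_inv]; monoidal

lemma psi_delta_right (X Y : V) :
    c.psi X Y ≫
      A ◁ (((c.delta ▷ X ≫ (α_ A (B ⊗ B) X).hom ≫ A ◁ (α_ B B X).hom) ⊗ₘ
          (c.delta ▷ Y ≫ (α_ A (B ⊗ B) Y).hom ≫ A ◁ (α_ B B Y).hom)) ≫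
        tensorφ A (B ⊗ (B ⊗ X)) (B ⊗ (B ⊗ Y))) ≫
      (α_ A A ((B ⊗ (B ⊗ X)) ⊗ (B ⊗ (B ⊗ Y)))).inv ≫ μ ▷ ((B ⊗ (B ⊗ X)) ⊗ (B ⊗ (B ⊗ Y))) =
    (c.𝔡 ⊗≫ A ◁ (c.delta ⊗ₘ c.delta) ⊗≫ (A ⊗ A) ◁ (β_ (B ⊗ B) A).hom ▷ (B ⊗ B) ⊗≫
        (μ[A] ▷ A ≫ μ[A]) ▷ (B ⊗ (B ⊗ (B ⊗ B)))) ▷ (X ⊗ Y) ⊗≫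
      (A ⊗ B ⊗ B) ◁ (β_ X (B ⊗ B)).inv ▷ Y ⊗≫ 𝟙 _ := by
  rw [MonoidalCategory.tensorHom_def, MonoidalCategory.tensorHom_def, tensorφ, tensorμ,
    BraidedCategory.braiding_tensor_left_hom, BraidedCategory.braiding_tensor_left_hom,
    BraidedCategory.braiding_tensor_left_hom B B A]
  calc
    _ = c.𝔡 ▷ (X ⊗ Y) ⊗≫ A ◁ (B ◁ (β_ X B).inv ≫ c.delta ▷ (X ⊗ B)) ▷ Y ⊗≫
        (A ⊗ A ⊗ B ⊗ B) ◁ (X ◁ c.delta ≫ (α_ X A (B ⊗ B)).inv ≫ (β_ X A).hom ▷ (B ⊗ B)) ▷ Y ⊗≫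
        (A ⊗ A ⊗ B) ◁ (β_ B A).hom ▷ (X ⊗ B ⊗ B ⊗ Y) ⊗≫
        (A ⊗ A) ◁ (β_ B A).hom ▷ (B ⊗ X ⊗ B ⊗ B ⊗ Y) ⊗≫
        ((α_ A A A).hom ≫ A ◁ μ[A] ≫ μ[A]) ▷ (B ⊗ B ⊗ X ⊗ B ⊗ B ⊗ Y) ⊗≫ 𝟙 _ := by
      rw [psi]; monoidal
    _ = c.𝔡 ▷ (X ⊗ Y) ⊗≫ A ◁ c.delta ▷ (B ⊗ X ⊗ Y) ⊗≫
        (A ⊗ A ⊗ B ⊗ B) ◁ ((β_ X B).inv ≫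
          X ◁ c.delta ≫ (α_ X A (B ⊗ B)).inv ≫ (β_ X A).hom ▷ (B ⊗ B)) ▷ Y ⊗≫
        (A ⊗ A ⊗ B) ◁ (β_ B A).hom ▷ (X ⊗ B ⊗ B ⊗ Y) ⊗≫
        (A ⊗ A) ◁ (β_ B A).hom ▷ (B ⊗ X ⊗ B ⊗ B ⊗ Y) ⊗≫
        (μ[A] ▷ A ≫ μ[A]) ▷ (B ⊗ B ⊗ X ⊗ B ⊗ B ⊗ Y) ⊗≫ 𝟙 _ := by
      rw [whisker_exchange c.delta, MonObj.mul_assoc]; monoidal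
    _ = c.𝔡 ▷ (X ⊗ Y) ⊗≫ A ◁ (c.delta ▷ B ≫ (A ⊗ B ⊗ B) ◁ c.delta) ▷ (X ⊗ Y) ⊗≫
        ((A ⊗ A ⊗ B ⊗ B ⊗ A) ◁ (β_ X (B ⊗ B)).inv ≫
          (𝟙 _ ⊗≫ (A ⊗ A ⊗ B) ◁ (β_ B A).hom ⊗≫ (A ⊗ A) ◁ (β_ B A).hom ▷ B ⊗≫
            (μ[A] ▷ A ≫ μ[A]) ▷ (B ⊗ B) :
              A ⊗ A ⊗ B ⊗ B ⊗ A ⟶ A ⊗ B ⊗ B) ▷ (X ⊗ B ⊗ B)) ▷ Y ⊗≫ 𝟙 _ := by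
      rw [braiding_inv_comp_whiskerLeft_braiding]; monoidal
    _ = _ := by
      rw [whisker_exchange _ (β_ X (B ⊗ B)).inv, ← MonoidalCategory.tensorHom_def]; monoidal

theorem psi_delta (X Y : V) :
    (c.delta ▷ (X ⊗ Y) ≫ (α_ A (B ⊗ B) (X ⊗ Y)).hom ≫ A ◁ (α_ B B (X ⊗ Y)).hom) ≫
      A ◁ ((B ◁ c.psi X Y ≫ (α_ B A ((B ⊗ X) ⊗ (B ⊗ Y))).inv ≫ c.zeta ▷ ((B ⊗ X) ⊗ (B ⊗ Y)) ≫
          (α_ A B ((B ⊗ X) ⊗ (B ⊗ Y))).hom) ≫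
        A ◁ c.psi (B ⊗ X) (B ⊗ Y) ≫
        (α_ A A ((B ⊗ (B ⊗ X)) ⊗ (B ⊗ (B ⊗ Y)))).inv ≫ μ ▷ ((B ⊗ (B ⊗ X)) ⊗ (B ⊗ (B ⊗ Y)))) ≫
      (α_ A A ((B ⊗ (B ⊗ X)) ⊗ (B ⊗ (B ⊗ Y)))).inv ≫ μ ▷ ((B ⊗ (B ⊗ X)) ⊗ (B ⊗ (B ⊗ Y))) =
    c.psi X Y ≫
      A ◁ (((c.delta ▷ X ≫ (α_ A (B ⊗ B) X).hom ≫ A ◁ (α_ B B X).hom) ⊗ₘ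
          (c.delta ▷ Y ≫ (α_ A (B ⊗ B) Y).hom ≫ A ◁ (α_ B B Y).hom)) ≫
        tensorφ A (B ⊗ (B ⊗ X)) (B ⊗ (B ⊗ Y))) ≫
      (α_ A A ((B ⊗ (B ⊗ X)) ⊗ (B ⊗ (B ⊗ Y)))).inv ≫ μ ▷ ((B ⊗ (B ⊗ X)) ⊗ (B ⊗ (B ⊗ Y))) := by
  rw [psi_delta_left, psi_delta_right, c.𝔡_δ]

end MonoidalTwistedCoaction

end MonoidalCoaction

/-! ### The opmonoidal comonad on the Kleisli category -/

section Kleisli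

variable {C : Type u} [Category.{v} C] {T : CategoryTheory.Monad C}

lemma kleisli_comp_toKleisli {X Y Z : C} (f : X ⟶ T.obj Y) (g : Y ⟶ Z) :
    f ≫ T.map (g ≫ T.η.app Z) ≫ T.μ.app Z = f ≫ T.map g := by
  simp

lemma toKleisli_comp_kleisli {X Y Z : C} (g : X ⟶ Y) (f : Y ⟶ T.obj Z) :
    (g ≫ T.η.app Y) ≫ T.map f ≫ T.μ.app Z = g ≫ f := by
  have h : f ≫ T.η.app (T.obj Z) = T.η.app Y ≫ T.map f := T.η.naturality f
  rw [Category.assoc, ← reassoc_of% h, T.left_unit]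
  exact congrArg _ (Category.comp_id f)

end Kleisli

namespace MonoidalTwistedCoaction

variable {V : Type u} [Category.{v} V] [MonoidalCategory V] [BraidedCategory V] {A B : V}
  [MonObj A] [BimonObj B] (c : MonoidalTwistedCoaction A B)

/-- The mixed opwreath given by a twisted coaction. -/
abbrev opwreath : MixedOpwreath (tensorMonad A) := ⟨c.opwreathData, c.isMixedOpwreath⟩

/-- The constraints of the Kleisli category come from `V`; this reduces the coherence axioms of the
lifted comonad to equations in `V`. -/
lemma liftedComonad_map_toKleisli {X Y : V} (f : X ⟶ Y) :
    c.opwreath.liftedComonad.map ((Kleisli.Adjunction.toKleisli (tensorMonad A)).map f) =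
      (Kleisli.Adjunction.toKleisli (tensorMonad A)).map (B ◁ f) := by
  apply Kleisli.hom_ext
  change c.opwreathData.G.map (f ≫ (tensorMonad A).η.app Y) ≫ c.opwreathData.ζ.app Y =
    B ◁ f ≫ (tensorMonad A).η.app (c.opwreathData.G.obj Y)
  rw [Functor.map_comp, Category.assoc, c.isMixedOpwreath.ζ_unit]
  rfl

variable [IsCommMonObj A]

/-- The tensor constraint of the comonad on the Kleisli category of `A ⊗ -`. -/
abbrev liftedδ (X Y : Kleisli (tensorMonad A)) :
    c.opwreath.liftedComonad.obj (X ⊗ Y) ⟶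
      c.opwreath.liftedComonad.obj X ⊗ c.opwreath.liftedComonad.obj Y :=
  .mk (c.psi X.of Y.of)

lemma liftedδ_natural {X X' Y Y' : Kleisli (tensorMonad A)} (f : X ⟶ Y) (f' : X' ⟶ Y') :
    c.liftedδ X X' ≫ (c.opwreath.liftedComonad.map f ⊗ₘ c.opwreath.liftedComonad.map f') =
      c.opwreath.liftedComonad.map (f ⊗ₘ f') ≫ c.liftedδ Y Y' :=
  Kleisli.hom_ext (c.psi_natural f.of f'.of)

/-- The opmonoidal structure of the comonad on the Kleisli category of `A ⊗ -`. -/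
abbrev liftedOplaxMonoidal : c.opwreath.liftedComonad.toFunctor.OplaxMonoidal where
  -- The only possible choice, by the unit condition for the counit to be opmonoidal.
  η := c.opwreath.liftedComonad.ε.app (𝟙_ _)
  δ X Y := c.liftedδ X Y
  δ_natural_left f X' := by
    rw [← tensorHom_id, ← CategoryTheory.Functor.map_id, liftedδ_natural, tensorHom_id]
  δ_natural_right X' f := by
    rw [← id_tensorHom, ← CategoryTheory.Functor.map_id, liftedδ_natural, id_tensorHom]
  oplax_associativity X Y Z := by
    refine (Category.assoc _ _ _).symm.trans (Eq.trans ?_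
      (congrArg (· ≫ _) (c.liftedComonad_map_toKleisli (α_ X.of Y.of Z.of).hom).symm))
    apply Kleisli.hom_ext
    refine (kleisli_comp_toKleisli (T := tensorMonad A) _ _).trans
      (Eq.trans ?_ (toKleisli_comp_kleisli (T := tensorMonad A) _ _).symm)
    refine Eq.trans ?_ (c.psi_assoc X.of Y.of Z.of)
    exact (Category.assoc _ _ _).trans (whisker_eq _ ((Category.assoc _ _ _).trans
      (whisker_eq _ (Category.assoc _ _ _))))
  oplax_left_unitality X := by
    refine Eq.trans ?_ (congrArg (· ≫ _) (c.liftedComonad_map_toKleisli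
      (λ_ X.of).inv).symm)
    apply Kleisli.hom_ext
    refine Eq.trans ?_ (toKleisli_comp_kleisli (T := tensorMonad A) _ _).symm
    exact (c.psi_counit_left X.of).symm
  oplax_right_unitality X := by
    refine Eq.trans ?_ (congrArg (· ≫ _) (c.liftedComonad_map_toKleisli
      (ρ_ X.of).inv).symm)
    apply Kleisli.hom_ext
    refine Eq.trans ?_ (toKleisli_comp_kleisli (T := tensorMonad A) _ _).symm
    exact (c.psi_counit_right X.of).symm

/-- The opmonoidal structure of the mixed opwreath. -/
abbrev opmonoidal : c.opwreath.Opmonoidal :=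
  letI := c.liftedOplaxMonoidal
  { isOpmonoidal_ε :=
      { unit := Category.comp_id _
        tensor := fun X Y => by
          refine (Category.comp_id _).trans ?_
          exact Kleisli.hom_ext (c.psi_eps X.of Y.of) }
    isOpmonoidal_δ :=
      { unit := by
          -- As the unit constraint is the counit at the unit object, this condition is an instance
          -- of a counit law of the comonad.
          refine (Category.assoc _ _ _).symm.trans ?_
          refine (congrArg (· ≫ _)
            (c.opwreath.liftedComonad.right_counit (𝟙_ (Kleisli (tensorMonad A))))).trans ?_
          exact Category.id_comp _
        tensor := fun X Y => Kleisli.hom_ext (c.psi_delta X.of Y.of) } }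

end MonoidalTwistedCoaction

end MixedWreath

open CategoryTheory MonoidalCategory MixedWreath in
theorem mainTheorem2 {V : Type*} [Category V] [MonoidalCategory V] [BraidedCategory V]
    (A B : V) [MonObj A] [IsCommMonObj A] [BimonObj B] (c : MonoidalTwistedCoaction A B) :
    ∃ (h : c.opwreathData.IsMixedOpwreath)
      (O : (MixedOpwreath.mk c.opwreathData h).Opmonoidal),
      (∀ X X' : V, O.ψ X X' = c.psi X X') ∧
      ∃ M : MonoidalCategory (MixedOpwreath.mk c.opwreathData h).Mkl,
        M.toMonoidalCategoryStruct =
          cokleisliMonoidalStruct (MixedOpwreath.mk c.opwreathData h).liftedComonad :=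
  ⟨c.isMixedOpwreath, c.opmonoidal, fun _ _ => rfl,
    -- The second `rfl` below holds because `cokleisliMonoidal` is built by `ofTensorHom` on top of
    -- `cokleisliMonoidalStruct`, without changing its data.
    letI := c.opmonoidal
    ⟨cokleisliMonoidal c.opwreath.liftedComonad, rfl⟩⟩
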